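/- Let $\mathcal X,\mathcal Y$ be finite alphabets, $W$ a discrete memoryless channel from $\mathcal X$ to $\mathcal Y$, and $q:\mathcal P(\mathcal X\times\mathcal Y)\to\mathbb R$ a continuous type-dependent decoding metric: a codebook $\{\boldsymbol x_1,\dots,\boldsymbol x_M\}\subset\mathcal X^n$ is decoded from $\boldsymbol y$ by maximizing $q(\hat P_{\boldsymbol x_i\boldsymbol y})$, where $\hat P$ denotes the (joint) type, ties count as errors, and messages are equiprobable. Let $P\in\mathcal P(\mathcal X)$, $R>0$, $\delta>0$, $\Delta\in\mathbb R$; logarithms are natural. For $Q\in\mathcal P(\mathcal X\times\mathcal X)$ put $$\beta_{R,W,q}(Q)=\min_{V_{X\tilde XY}:\ V_{X\tilde X}=Q,\ q(V_{\tilde XY})\ge q(V_{XY})}\Big\{D(V_{Y|X}\|W|V_X)+\big|I_V(\tilde X;Y,X)-R\big|_+\Big\}\in[0,\infty],$$ where $|t|_+=\max\{t,0\}$. Assume the rate condition $$R\le\min_{\substack{P_{X\tilde X}:\ P_X=P_{\tilde X}=P\\ \beta_{R,W,q}(P_{X\tilde X})\le\Delta}}I(X;\tilde X)-2\delta .$$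 (A minimum over the empty set is $+\infty$.) For all large $n$ let $P_n$ be a type of length $n$ with the same support as $P$ and $\max_x|P_n(x)-P(x)|\le 1/n$, with type class $\mathcal T(P_n)\subset\mathcal X^n$, and let the numbers of codewords $M_n$ have asymptotic rate at most $R$, i.e. $\limsup_n\frac1n\log M_n\le R$ (for instance $M_n=\lfloor e^{nR}\rfloor$). Let $$d(\boldsymbol x,\boldsymbol x')=\min\{\beta_{R,W,q}(\hat P_{\boldsymbol x\boldsymbol x'}),\ \beta_{R,W,q}(\hat P_{\boldsymbol x'\boldsymbol x})\},$$ which is $\beta_{R,W,q}(\hat P_{\boldsymbol x\boldsymbol x'})$ itself whenever $\beta_{R,W,q}$ is symmetric. The generalized random Gilbert–Varshamov (RGV) codebook is drawn recursively: for $i=1,\dots,M_n$, $\boldsymbol x_i$ is uniform on $\{\bar{\boldsymbol x}\in\mathcal T(P_n): d(\bar{\boldsymbol x},\boldsymbol x_j)>\Delta,\ j=1,\dots,i-1\}$. Then, for all sufficiently large $n$, the condition $M_n e^{n\delta}\,|\{\bar{\boldsymbol x}\in\mathcal T(P_n):d(\bar{\boldsymbol x},\boldsymbol x)\le\Delta\}|\le|\mathcal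 T(P_n)|$ holds for every $\boldsymbol x\in\mathcal T(P_n)$ and the construction is well defined (the sets from which codewords are drawn are never empty), and the average $\bar P_{\mathrm e}^{(n)}$ of the error probability over the channel and the random codebook satisfies $$\bar P_{\mathrm e}^{(n)}\ \dot\le\ e^{-n\Delta},\qquad\text{i.e.}\quad \limsup_{n\to\infty}\frac1n\log\frac{\bar P_{\mathrm e}^{(n)}}{e^{-n\Delta}}\le 0 \quad(\log 0=-\infty).$$ -/

import Mathlib

/-! Finite-alphabet distributions are real functions on the alphabet lying in `stdSimplex ℝ _`.
Divergences and distances take values in `EReal`, since a divergence may be `+∞`. -/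

namespace RGV

noncomputable section

variable {α β X Y : Type*} [Fintype α] [Fintype β] [Fintype X] [Fintype Y]
  [DecidableEq α] [DecidableEq β] [DecidableEq X] [DecidableEq Y]

/-! ### Distributions, mutual information, divergence -/

/-- Image of a distribution `V` under `f`; marginals are images under coordinate maps. -/
def push (f : α → β) (V : α → ℝ) : β → ℝ :=
  fun b => ∑ a ∈ Finset.univ.filter (fun a => f a = b), V a

/-- `I(A;B) = ∑ V(a,b) log (V(a,b) / (V_A(a) V_B(b)))`, in nats. Terms with `V(a,b) = 0` vanish. -/
def mutualInfo (V : α × β → ℝ) : ℝ :=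
  ∑ a, ∑ b, V (a, b) * Real.log (V (a, b) / (push Prod.fst V a * push Prod.snd V b))

open Classical in
/-- `D(V_{Y|X} ‖ W | V_X) = ∑ V(x,y) log (V(y|x) / W(y|x))` for a joint distribution `V` of
`(X, Y)`; it is `+∞` when `V` charges a pair with `W(y|x) = 0`. -/
def condDiv (W : X → Y → ℝ) (V : X × Y → ℝ) : EReal :=
  if ∀ x y, W x y = 0 → V (x, y) = 0 then
    ((∑ x, ∑ y, V (x, y) * Real.log (V (x, y) / (push Prod.fst V x * W x y)) : ℝ) : EReal)
  else ⊤

/-! Marginals of a distribution on triples `(X, X̃, Y)`. -/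

/-- `V_{X X̃}` -/
def margXX (V : X × X × Y → ℝ) : X × X → ℝ := push (fun t => (t.1, t.2.1)) V

/-- `V_{X Y}` -/
def margXY (V : X × X × Y → ℝ) : X × Y → ℝ := push (fun t => (t.1, t.2.2)) V

/-- `V_{X̃ Y}` -/
def margX'Y (V : X × X × Y → ℝ) : X × Y → ℝ := push (fun t => (t.2.1, t.2.2)) V

/-- `I_V(X̃; Y, X)` -/
def infoX'_XY (V : X × X × Y → ℝ) : ℝ :=
  mutualInfo (push (fun t : X × X × Y => (t.2.1, (t.1, t.2.2))) V)

/-! ### The distance function -/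

/-- `Γ(V) = D(V_{Y|X} ‖ W | V_X) + |I(X̃; Y, X) - R|₊` -/
def Gam (R : ℝ) (W : X → Y → ℝ) (V : X × X × Y → ℝ) : EReal :=
  condDiv W (margXY V) + ((max (infoX'_XY V - R) 0 : ℝ) : EReal)

/-- `𝒯'(Q)`: the `V_{X X̃ Y}` with `V_{X X̃} = Q` and `q(V_{X̃ Y}) ≥ q(V_{X Y})`. -/
def tPrime (q : (X × Y → ℝ) → ℝ) (Q : X × X → ℝ) : Set (X × X × Y → ℝ) :=
  {V | V ∈ stdSimplex ℝ (X × X × Y) ∧ margXX V = Q ∧ q (margXY V) ≤ q (margX'Y V)}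

/-- `β_{R,W,q}(Q) = min { Γ(V) : V ∈ 𝒯'(Q) }`; it is `+∞` if the set is empty. -/
def betaDist (R : ℝ) (W : X → Y → ℝ) (q : (X × Y → ℝ) → ℝ) (Q : X × X → ℝ) : EReal :=
  ⨅ V ∈ tPrime q Q, Gam R W V

/-- `min { I(X;X̃) : P_X = P_X̃ = P, d(P_{X X̃}) ≤ Δ }`; it is `+∞` if the set is empty. -/
def minInfo (P : X → ℝ) (d : (X × X → ℝ) → EReal) (Δ : ℝ) : EReal :=
  ⨅ Q ∈ {Q : X × X → ℝ | Q ∈ stdSimplex ℝ (X × X) ∧ push Prod.fst Q = P ∧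
    push Prod.snd Q = P ∧ d Q ≤ (Δ : EReal)}, (mutualInfo Q : EReal)

/-- The symmetrized distance `min {d(x, x'), d(x', x)}`. -/
def symmetrize (d : (X × X → ℝ) → EReal) (Q : X × X → ℝ) : EReal :=
  min (d Q) (d (push Prod.swap Q))

/-- Where the distance is symmetric, symmetrizing does not change it. -/
theorem symmetrize_eq_self (d : (X × X → ℝ) → EReal) (Q : X × X → ℝ)
    (h : d (push Prod.swap Q) = d Q) : symmetrize d Q = d Q := by
  simp [symmetrize, h]

/-! ### Types and sequences -/

/-- The type (empirical distribution) of a sequence. -/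
def empirical {n : ℕ} (x : Fin n → α) : α → ℝ :=
  fun a => ((Finset.univ.filter (fun i => x i = a)).card : ℝ) / n

/-- The joint type of two sequences. -/
def jointType {n : ℕ} (x : Fin n → α) (y : Fin n → β) : α × β → ℝ :=
  empirical (fun i => (x i, y i))

open Classical in
/-- The type class `𝒯(p)` of sequences of length `n`. -/
def typeClass (n : ℕ) (p : α → ℝ) : Finset (Fin n → α) :=
  Finset.univ.filter (fun x => empirical x = p)

/-- `p` is a type of length `n` with the support of `P` and `max |p - P| ≤ 1/n`. -/
def IsTypeApprox (P : α → ℝ) (n : ℕ) (p : α → ℝ) : Prop :=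
  (typeClass n p).Nonempty ∧ Function.support p = Function.support P ∧
    ∀ a, |p a - P a| ≤ 1 / (n : ℝ)

/-! ### The random codebook -/

open Classical in
/-- `𝒯(p, x₁, …, x_{i-1})`: the sequences of type `p` at distance more than `Δ` from all
codewords of `c` that precede `i`. -/
def available {n M : ℕ} (p : X → ℝ) (d : (X × X → ℝ) → EReal) (Δ : ℝ)
    (c : Fin M → Fin n → X) (i : Fin M) : Finset (Fin n → X) :=
  (typeClass n p).filter (fun z => ∀ j < i, (Δ : EReal) < d (jointType z (c j)))

open Classical in
/-- Probability that the recursive construction, drawing the `i`-th codeword uniformly from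
`available p d Δ c i`, produces the codebook `c`. -/
def codebookProb {n M : ℕ} (p : X → ℝ) (d : (X × X → ℝ) → EReal) (Δ : ℝ)
    (c : Fin M → Fin n → X) : ℝ :=
  ∏ i, if c i ∈ available p d Δ c i then 1 / ((available p d Δ c i).card : ℝ) else 0

/-- The construction never gets stuck: after any codewords that can have been drawn, there is a
next codeword to draw. -/
def NeverStuck (n M : ℕ) (p : X → ℝ) (d : (X × X → ℝ) → EReal) (Δ : ℝ) : Prop :=
  ∀ (c : Fin M → Fin n → X) (i : Fin M),
    (∀ k < i, c k ∈ available p d Δ c k) → (available p d Δ c i).Nonempty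

open Classical in
/-- The condition `M e^{nδ} vol_x(Δ) ≤ |𝒯(p)|` imposed on the construction, where
`vol_x(Δ)` is the number of sequences of type `p` within distance `Δ` of `x`. -/
def VolumeCondition (n M : ℕ) (p : X → ℝ) (d : (X × X → ℝ) → EReal) (Δ δ : ℝ) : Prop :=
  ∀ x ∈ typeClass n p,
    (M : ℝ) * Real.exp (n * δ) *
      (((typeClass n p).filter (fun z => d (jointType z x) ≤ (Δ : EReal))).card : ℝ)
      ≤ ((typeClass n p).card : ℝ)

/-! ### Error probability -/

open Classical in
/-- Error probability of the codebook `c` over the memoryless channel `W`, for equiprobable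
messages and the maximum metric decoder with metric `q`; ties count as errors. -/
def errorProb {n M : ℕ} (W : X → Y → ℝ) (q : (X × Y → ℝ) → ℝ) (c : Fin M → Fin n → X) : ℝ :=
  (1 / (M : ℝ)) * ∑ m : Fin M, ∑ y : Fin n → Y,
    if ∃ i, i ≠ m ∧ q (jointType (c m) y) ≤ q (jointType (c i) y) then
      ∏ k, W (c m k) (y k)
    else 0

/-- The ensemble average error probability. -/
def ensembleErrorProb (n M : ℕ) (p : X → ℝ) (d : (X × X → ℝ) → EReal) (Δ : ℝ)
    (W : X → Y → ℝ) (q : (X × Y → ℝ) → ℝ) : ℝ :=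
  ∑ c : Fin M → Fin n → X, codebookProb p d Δ c * errorProb W q c

/-- `f ≤̇ g`, that is `limsup (1/n) log (f n / g n) ≤ 0`, for `f ≥ 0` (with `log 0 = -∞`) and
`g > 0`. -/
def DotLE (f g : ℕ → ℝ) : Prop :=
  ∀ ε > 0, ∀ᶠ n : ℕ in Filter.atTop, f n ≤ Real.exp (n * ε) * g n

end

end RGV

namespace RGV

noncomputable section

open Finset Filter Topology

set_option linter.unusedSectionVars false

/-! The proof is the method of types applied to a codebook whose codewords are almost independent.

Volume. A ball in the type class splits into polynomially many conditional type classes, and the one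
of joint type `Q` has size at most `|𝒯(P_n)| exp(-n I(Q))` up to a polynomial
(`card_condTypeClass_le`). The rate condition bounds `I(Q)` from below when the marginals are
exactly `P`. Since `β` is a minimum of a continuous function over a compact set, compactness extends
the bound, with a small loss, to marginals near `P` (`exists_forall_le_mutualInfo`). The slack `2δ`
pays for `exp(nδ)` and all losses.

Codebook. By the volume condition the balls around earlier codewords cover at most half of the type
class, so each draw has conditional probability at most `2/|𝒯(P_n)|` at every sequence. Hence
prescribed values of any set `s` of codewords have probability at most `(2/|𝒯(P_n)|)^|s|`
(`sum_codebookProb_le`): up to constants, pairs behave as if independent.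

Error. Any two codewords are at distance greater than `Δ`. For sent `x` and received `y`, a union
bound truncated at 1 involves only rivals `x'` with `d(x,x') > Δ` that win the metric comparison.
Group them by the joint type `V` of `(x,x',y)`. The outputs `y` compatible with `V` have probability
at most `exp(-n D)`, and the truncated count is at most about `exp(-n|I-R|₊)`; together these give
`exp(-n Γ(V))` (`sum_channel_mul_min_le`). Such a `V` is admissible in the minimum defining `β` at
the joint type of `(x,x')`, so `Γ(V) ≥ β > Δ`. There are polynomially many `V`. -/

/-! ### Counting sequences of a given type -/

/-- The number of occurrences of a letter in a sequence. -/
def occ {α : Type*} [DecidableEq α] {n : ℕ} (x : Fin n → α) (a : α) : ℕ :=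
  (univ.filter (fun i => x i = a)).card

section Counting

variable {α β γ : Type*} [Fintype α] [Fintype β] [Fintype γ]
  [DecidableEq α] [DecidableEq β] [DecidableEq γ]

theorem empirical_apply {n : ℕ} (x : Fin n → α) (a : α) :
    empirical x a = (occ x a : ℝ) / n := rfl

theorem sum_occ {n : ℕ} (x : Fin n → α) : ∑ a, occ x a = n := by
  have := Finset.card_eq_sum_card_fiberwise (f := x) (s := univ) (t := univ) (by simp)
  simpa [occ] using this.symm

theorem occ_le {n : ℕ} (x : Fin n → α) (a : α) : occ x a ≤ n :=
  (Finset.card_filter_le _ _).trans (by simp)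

theorem occ_cons {n : ℕ} (a : α) (x : Fin n → α) (b : α) :
    occ (Fin.cons a x : Fin (n + 1) → α) b = (if a = b then 1 else 0) + occ x b := by
  unfold occ
  rw [Fin.card_filter_univ_succ']
  simp

/-- The multinomial coefficient, by induction on the first letter: fixing it to be `a` removes one
`a` from the composition and leaves `k a * n!`. Summing over `a` gives `(n + 1) * n!`. -/
theorem card_occ_eq_mul_prod_factorial (n : ℕ) (k : α → ℕ) (hk : ∑ a, k a = n) :
    (univ.filter (fun x : Fin n → α => occ x = k)).card * ∏ a, (k a).factorial
      = n.factorial := by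
  induction n generalizing k with
  | zero =>
    have h0 : ∀ a, k a = 0 := by simpa using hk
    have : ∀ x : Fin 0 → α, occ x = k := fun x => by
      funext a; simp [occ, h0 a]
    simp [this, h0]
  | succ n ih =>
    have hsplit : (univ.filter (fun x : Fin (n + 1) → α => occ x = k)).card
        = ∑ a, (univ.filter (fun x : Fin n → α => occ (Fin.cons a x : Fin (n + 1) → α) = k)).card := by
      simp only [Finset.card_filter]
      rw [← (Fin.consEquiv (fun _ : Fin (n + 1) => α)).sum_comp, Fintype.sum_prod_type]
      rfl
    have hterm : ∀ a, (univ.filter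
        (fun x : Fin n → α => occ (Fin.cons a x : Fin (n + 1) → α) = k)).card
          * ∏ b, (k b).factorial = k a * n.factorial := by
      intro a
      rcases Nat.eq_zero_or_pos (k a) with h | h
      · rw [Finset.filter_false_of_mem, h]
        · simp
        · intro x _ hx
          have := congrFun hx a
          rw [occ_cons] at this
          simp [h] at this
      · set k' : α → ℕ := fun b => k b - (if a = b then 1 else 0) with hk'
        have hkk : ∀ b, k b = (if a = b then 1 else 0) + k' b := by
          intro b
          by_cases hb : a = b
          · subst hb; simp [hk']; omega
          · simp [hk', hb]
        have hsum : ∑ b, k' b = n := by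
          have : ∑ b, k b = 1 + ∑ b, k' b := by
            rw [Finset.sum_congr rfl (fun b _ => hkk b), Finset.sum_add_distrib]
            simp
          omega
        have hset : (univ.filter (fun x : Fin n → α => occ (Fin.cons a x : Fin (n + 1) → α) = k))
            = univ.filter (fun x : Fin n → α => occ x = k') := by
          ext x
          simp only [Finset.mem_filter, Finset.mem_univ, true_and, funext_iff, occ_cons]
          refine forall_congr' fun b => ?_
          rw [hkk b]
          omega
        have hprod : ∏ b, (k b).factorial = k a * ∏ b, (k' b).factorial := by
          rw [← Finset.mul_prod_erase univ (fun b => (k b).factorial) (Finset.mem_univ a),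
            ← Finset.mul_prod_erase univ (fun b => (k' b).factorial) (Finset.mem_univ a),
            ← mul_assoc]
          have ha : k' a = k a - 1 := by simp [hk']
          rw [ha, Nat.mul_factorial_pred h.ne']
          congr 1
          refine Finset.prod_congr rfl fun b hb => ?_
          have : a ≠ b := (Finset.ne_of_mem_erase hb).symm
          simp [hk', this]
        rw [hset, hprod, mul_left_comm, ih k' hsum]
    rw [hsplit, Finset.sum_mul, Finset.sum_congr rfl (fun a _ => hterm a), ← Finset.sum_mul, hk,
      Nat.factorial_succ]

/-- A crude Stirling bound, precise up to a polynomial factor. The induction step is `(1 -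
1/(m+2))^(m+2) ≤ 1/e`. The factor `k + 1` in place of `k` keeps the case `k = 0` true. -/
theorem factorial_mul_exp_le (k : ℕ) :
    (k.factorial : ℝ) * Real.exp k ≤ Real.exp 1 * (k + 1) * (k : ℝ) ^ k := by
  have key : ∀ m : ℕ, ((m + 1).factorial : ℝ) * Real.exp ((m + 1 : ℕ) : ℝ)
      ≤ Real.exp 1 * ((m + 1 : ℕ) : ℝ) ^ (m + 2) := by
    intro m
    induction m with
    | zero => simp
    | succ m ih =>
      have h1 : ((m + 1 : ℕ) : ℝ) ^ (m + 2) * Real.exp 1 ≤ ((m + 2 : ℕ) : ℝ) ^ (m + 2) := by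
        have h := Real.one_sub_div_pow_le_exp_neg (n := m + 2) (t := 1) (by push_cast; linarith)
        have h2 : (1 - 1 / ((m + 2 : ℕ) : ℝ)) = ((m + 1 : ℕ) : ℝ) / ((m + 2 : ℕ) : ℝ) := by
          push_cast; field_simp; ring
        rw [h2, div_pow, Real.exp_neg, div_le_iff₀ (by positivity)] at h
        calc ((m + 1 : ℕ) : ℝ) ^ (m + 2) * Real.exp 1
            ≤ ((Real.exp 1)⁻¹ * ((m + 2 : ℕ) : ℝ) ^ (m + 2)) * Real.exp 1 := by gcongr
          _ = _ := by field_simp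
      calc ((m + 1 + 1).factorial : ℝ) * Real.exp ((m + 1 + 1 : ℕ) : ℝ)
          = (m + 2 : ℕ) * Real.exp 1 * (((m + 1).factorial : ℝ) * Real.exp ((m + 1 : ℕ) : ℝ)) := by
            rw [Nat.factorial_succ, Nat.cast_succ (m + 1), Real.exp_add]
            push_cast; ring
        _ ≤ (m + 2 : ℕ) * Real.exp 1 * (Real.exp 1 * ((m + 1 : ℕ) : ℝ) ^ (m + 2)) := by gcongr
        _ = Real.exp 1 * (m + 2 : ℕ) * (((m + 1 : ℕ) : ℝ) ^ (m + 2) * Real.exp 1) := by ring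
        _ ≤ Real.exp 1 * (m + 2 : ℕ) * (((m + 2 : ℕ) : ℝ) ^ (m + 2)) := by gcongr
        _ = _ := by ring
  rcases k with _ | m
  · simp
  · refine (key m).trans ?_
    rw [pow_succ' _ (m + 1), ← mul_assoc]
    gcongr
    linarith

theorem prod_comp_occ {n : ℕ} (x : Fin n → α) (f : α → ℝ) :
    ∏ i, f (x i) = ∏ a, f a ^ occ x a := by
  rw [← Finset.prod_fiberwise univ x (fun i => f (x i))]
  refine Finset.prod_congr rfl fun a _ => ?_
  rw [Finset.prod_congr rfl (g := fun _ => f a)]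
  · simp [occ]
  · intro i hi
    simp [(Finset.mem_filter.1 hi).2]

/-- The polynomial factor of the method of types. -/
def polyFactor (α : Type*) [Fintype α] (n : ℕ) : ℝ := (Real.exp 1 * (n + 1)) ^ Fintype.card α

theorem polyFactor_pos (α : Type*) [Fintype α] (n : ℕ) : 0 < polyFactor α n := by
  unfold polyFactor; positivity

theorem mem_typeClass {n : ℕ} {p : α → ℝ} {x : Fin n → α} :
    x ∈ typeClass n p ↔ empirical x = p := by simp [typeClass]

theorem empirical_eq_iff {n : ℕ} (hn : n ≠ 0) (x y : Fin n → α) :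
    empirical x = empirical y ↔ occ x = occ y := by
  have hn' : (n : ℝ) ≠ 0 := Nat.cast_ne_zero.2 hn
  simp only [funext_iff, empirical_apply, div_left_inj' hn', Nat.cast_inj]

/-- A sequence of type `p` has `p`-probability at least `1 / (poly * |𝒯(p)|)`. -/
theorem one_le_card_typeClass_mul_prod {n : ℕ} (hn : n ≠ 0) (x : Fin n → α) :
    1 ≤ polyFactor α n * (typeClass n (empirical x)).card * ∏ i, empirical x (x i) := by
  have hn' : (0 : ℝ) < n := Nat.cast_pos.2 (Nat.pos_of_ne_zero hn)
  have hcard : (typeClass n (empirical x)).card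
      = (univ.filter (fun y : Fin n → α => occ y = occ x)).card := by
    unfold typeClass
    simp only [empirical_eq_iff hn]
  have hmult := card_occ_eq_mul_prod_factorial n (occ x) (sum_occ x)
  rw [← hcard] at hmult
  set T : ℝ := ((typeClass n (empirical x)).card : ℝ) with hT
  have hmult' : T * ∏ a, ((occ x a).factorial : ℝ) = n.factorial := by
    rw [hT]; exact_mod_cast hmult
  -- Stirling is applied to each `(occ x a)!`; since the counts add up to `n`, the exponentials
  -- combine to `exp n`, which then cancels against `n^n ≤ n! exp n`.
  have hfac : (∏ a, ((occ x a).factorial : ℝ)) * Real.exp n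
      ≤ polyFactor α n * ∏ a, (occ x a : ℝ) ^ occ x a := by
    have h1 : Real.exp n = ∏ a, Real.exp (occ x a) := by
      rw [← Real.exp_sum, ← Nat.cast_sum, sum_occ]
    rw [h1, ← Finset.prod_mul_distrib]
    have h2 : polyFactor α n * ∏ a, (occ x a : ℝ) ^ occ x a
        = ∏ a, (Real.exp 1 * (n + 1) * (occ x a : ℝ) ^ occ x a) := by
      rw [Finset.prod_mul_distrib]
      simp [polyFactor]
    rw [h2]
    refine Finset.prod_le_prod (fun a _ => by positivity) fun a _ => ?_
    refine (factorial_mul_exp_le _).trans ?_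
    have : (occ x a : ℝ) ≤ n := by exact_mod_cast occ_le x a
    gcongr
  have hnn : (n : ℝ) ^ n ≤ n.factorial * Real.exp n := by
    have := Real.pow_div_factorial_le_exp (n : ℝ) hn'.le n
    rw [div_le_iff₀ (by positivity)] at this
    linarith
  have hprod : ∏ i, empirical x (x i) = (∏ a, (occ x a : ℝ) ^ occ x a) / (n : ℝ) ^ n := by
    rw [prod_comp_occ x (empirical x)]
    simp only [empirical_apply, div_pow]
    rw [Finset.prod_div_distrib, Finset.prod_pow_eq_pow_sum, sum_occ]
  rw [hprod, ← mul_div_assoc, le_div_iff₀ (by positivity), one_mul]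
  calc (n : ℝ) ^ n ≤ n.factorial * Real.exp n := hnn
    _ = T * ((∏ a, ((occ x a).factorial : ℝ)) * Real.exp n) := by rw [← hmult']; ring
    _ ≤ T * (polyFactor α n * ∏ a, (occ x a : ℝ) ^ occ x a) := by gcongr
    _ = _ := by ring

/-! ### Empirical distributions and images -/

theorem push_empirical {n : ℕ} (f : α → β) (x : Fin n → α) :
    push f (empirical x) = empirical (fun i => f (x i)) := by
  funext b
  simp only [push, empirical]
  rw [← Finset.sum_div, ← Nat.cast_sum]
  congr 2
  rw [Finset.card_eq_sum_card_fiberwise (f := x) (t := univ.filter (fun a => f a = b))]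
  · refine Finset.sum_congr rfl fun a ha => ?_
    congr 1
    ext i
    simp only [Finset.mem_filter, Finset.mem_univ, true_and] at ha ⊢
    constructor
    · rintro rfl; exact ⟨ha, rfl⟩
    · exact fun h => h.2
  · intro i hi
    simpa using hi

theorem push_comp (f : α → β) (g : β → γ) (V : α → ℝ) :
    push g (push f V) = push (fun a => g (f a)) V := by
  funext c
  simp only [push]
  rw [Finset.sum_sigma']
  refine Finset.sum_nbij' (fun s => s.2) (fun a => ⟨f a, a⟩) ?_ ?_ ?_ ?_ ?_
  · rintro ⟨b, a⟩ h
    simp only [Finset.mem_sigma, Finset.mem_filter, Finset.mem_univ, true_and] at h ⊢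
    rw [h.2, h.1]
  · intro a h
    simpa using h
  · rintro ⟨b, a⟩ h
    simp only [Finset.mem_sigma, Finset.mem_filter, Finset.mem_univ, true_and] at h
    obtain ⟨-, rfl⟩ := h
    rfl
  · intro a _; rfl
  · intro s _; rfl

theorem push_mem_stdSimplex (f : α → β) {V : α → ℝ} (hV : V ∈ stdSimplex ℝ α) :
    push f V ∈ stdSimplex ℝ β := by
  refine ⟨fun b => Finset.sum_nonneg fun a _ => hV.1 a, ?_⟩
  rw [← hV.2]
  exact Finset.sum_fiberwise univ f V

theorem empirical_mem_stdSimplex {n : ℕ} (hn : n ≠ 0) (x : Fin n → α) :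
    empirical x ∈ stdSimplex ℝ α := by
  refine ⟨fun a => by unfold empirical; positivity, ?_⟩
  simp only [empirical_apply]
  rw [← Finset.sum_div, ← Nat.cast_sum, sum_occ, div_self (Nat.cast_ne_zero.2 hn)]

theorem empirical_pos {n : ℕ} (x : Fin n → α) (i : Fin n) : 0 < empirical x (x i) := by
  have hn : 0 < n := i.pos
  have : 0 < occ x (x i) := Finset.card_pos.2 ⟨i, by simp⟩
  rw [empirical_apply]
  positivity

theorem push_fst_jointType {n : ℕ} (x : Fin n → α) (y : Fin n → β) :
    push Prod.fst (jointType x y) = empirical x := push_empirical _ _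

theorem push_snd_jointType {n : ℕ} (x : Fin n → α) (y : Fin n → β) :
    push Prod.snd (jointType x y) = empirical y := push_empirical _ _

theorem push_swap_jointType {n : ℕ} (x : Fin n → α) (y : Fin n → β) :
    push Prod.swap (jointType x y) = jointType y x := push_empirical _ _

/-- The set of types of length `n`. -/
def types (α : Type*) [Fintype α] [DecidableEq α] (n : ℕ) : Finset (α → ℝ) :=
  (univ : Finset (Fin n → α)).image empirical

/-- A type is determined by counts in `{0, …, n}`. The bound `(n + 1)^|α|` is relaxed so that one
polynomial factor serves here and in the Stirling estimates. -/
theorem card_types_le (n : ℕ) : ((types α n).card : ℝ) ≤ polyFactor α n := by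
  have h : types α n ⊆ (univ : Finset (α → Fin (n + 1))).image
      (fun k a => ((k a : ℕ) : ℝ) / n) := by
    intro p hp
    obtain ⟨x, -, rfl⟩ := Finset.mem_image.1 hp
    refine Finset.mem_image.2 ⟨fun a => ⟨occ x a, Nat.lt_succ_of_le (occ_le x a)⟩, by simp, ?_⟩
    rfl
  have h2 : (types α n).card ≤ (n + 1) ^ Fintype.card α := by
    refine (Finset.card_le_card h).trans (Finset.card_image_le.trans ?_)
    simp
  calc ((types α n).card : ℝ) ≤ ((n : ℝ) + 1) ^ Fintype.card α := by exact_mod_cast h2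
    _ ≤ polyFactor α n := by
      unfold polyFactor
      gcongr
      have := Real.add_one_le_exp (1 : ℝ)
      nlinarith [Nat.cast_nonneg (α := ℝ) n]

/-! ### Exponential estimates -/

theorem prod_eq_exp_sum_empirical {n : ℕ} (x : Fin n → α) (f : α → ℝ) (hf : ∀ i, 0 < f (x i)) :
    ∏ i, f (x i) = Real.exp (n * ∑ a, empirical x a * Real.log (f a)) := by
  rcases Nat.eq_zero_or_pos n with rfl | hn
  · simp
  have hn' : (n : ℝ) ≠ 0 := by positivity
  rw [prod_comp_occ, Finset.mul_sum, Real.exp_sum]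
  refine Finset.prod_congr rfl fun a _ => ?_
  rcases Nat.eq_zero_or_pos (occ x a) with h | h
  · simp [empirical_apply, h]
  · obtain ⟨i, hi⟩ := Finset.card_pos.1 h
    have hi' : x i = a := by simpa using hi
    have hfa : 0 < f a := hi' ▸ hf i
    rw [empirical_apply, ← mul_assoc, mul_div_cancel₀ _ hn', ← Real.log_pow,
      Real.exp_log (by positivity)]

/-- Summing the products of a conditional distribution over all output sequences gives one. -/
theorem sum_prod_condProb {n : ℕ} (u : Fin n → α) (v : Fin n → β) :
    ∑ u' : Fin n → α, ∏ i, (jointType u v (u' i, v i) / empirical v (v i)) = 1 := by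
  rw [← Fintype.prod_sum (fun i a => jointType u v (a, v i) / empirical v (v i))]
  refine Finset.prod_eq_one fun i _ => ?_
  rw [← Finset.sum_div]
  have : ∑ a, jointType u v (a, v i) = empirical v (v i) := by
    rw [← push_snd_jointType u v]
    simp only [push, Finset.sum_filter, Fintype.sum_prod_type, Finset.sum_ite_eq',
      Finset.mem_univ, if_true]
  rw [this, div_self (empirical_pos v i).ne']

open Classical in
/-- The conditional type class of `u` given `v` has relative size at most `poly * exp (-n I)`. -/
theorem card_condTypeClass_le {n : ℕ} (hn : n ≠ 0) (u : Fin n → α) (v : Fin n → β) :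
    ((univ.filter (fun u' : Fin n → α => jointType u' v = jointType u v)).card : ℝ)
      ≤ polyFactor α n * (typeClass n (empirical u)).card *
        Real.exp (-(n * mutualInfo (jointType u v))) := by
  set N := univ.filter (fun u' : Fin n → α => jointType u' v = jointType u v) with hN
  set I := mutualInfo (jointType u v) with hI
  set π := ∏ i, empirical u (u i) with hπ
  have hπ0 : 0 < π := Finset.prod_pos fun i _ => empirical_pos u i
  -- Under the conditional law of `u` given `v`, every member of the class has the same probability
  -- `exp(nI) π`, with `π` the probability of `u` under its own type. These sum to at most 1, and
  -- `1/π` is at most the size of the type class up to a polynomial.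
  have hterm : ∀ u' ∈ N, ∏ i, (jointType u v (u' i, v i) / empirical v (v i))
      = Real.exp (n * I) * π := by
    intro u' hu'
    have hV : jointType u' v = jointType u v := by simpa [hN] using hu'
    have hU : empirical u' = empirical u := by
      rw [← push_fst_jointType u' v, hV, push_fst_jointType]
    have hπ' : π = ∏ i, empirical u (u' i) := by
      rw [hπ, prod_comp_occ u, prod_comp_occ u', (empirical_eq_iff hn u' u).1 hU]
    have hexp := prod_eq_exp_sum_empirical (fun i => (u' i, v i))
      (fun ab => jointType u v ab / (empirical u ab.1 * empirical v ab.2)) (by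
        intro i
        have h1 : 0 < jointType u v (u' i, v i) := by
          rw [← hV]; exact empirical_pos (fun i => (u' i, v i)) i
        have h2 : 0 < empirical u (u' i) := by rw [← hU]; exact empirical_pos u' i
        have h3 := empirical_pos v i
        positivity)
    have hI' : ∑ a, empirical (fun i => (u' i, v i)) a *
        Real.log (jointType u v a / (empirical u a.1 * empirical v a.2)) = I := by
      rw [hI, mutualInfo, push_fst_jointType, push_snd_jointType, Fintype.sum_prod_type]
      change ∑ a, ∑ b, jointType u' v (a, b) * _ = _
      rw [hV]
    rw [hI'] at hexp
    rw [← hexp, hπ', ← Finset.prod_mul_distrib]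
    refine Finset.prod_congr rfl fun i _ => ?_
    have h2 : 0 < empirical u (u' i) := by rw [← hU]; exact empirical_pos u' i
    have h3 := empirical_pos v i
    field_simp
  have hsum : (N.card : ℝ) * (Real.exp (n * I) * π) ≤ 1 := by
    rw [← sum_prod_condProb u v, ← nsmul_eq_mul, ← Finset.sum_const, ← Finset.sum_congr rfl hterm]
    refine Finset.sum_le_sum_of_subset_of_nonneg (Finset.subset_univ _) fun u' _ _ => ?_
    refine Finset.prod_nonneg fun i _ => ?_
    exact div_nonneg ((empirical_mem_stdSimplex hn _).1 _) (empirical_pos v i).le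
  have hlow := one_le_card_typeClass_mul_prod hn u
  rw [Real.exp_neg]
  have h1 : (N.card : ℝ) * (Real.exp (n * I) * π)
      ≤ polyFactor α n * (typeClass n (empirical u)).card * π := hsum.trans hlow
  rw [← mul_assoc] at h1
  have h2 := le_of_mul_le_mul_right h1 hπ0
  rw [← div_eq_mul_inv, le_div_iff₀ (Real.exp_pos _)]
  exact h2

end Counting

open Classical in
/-- The channel probability of a conditional type class is at most `exp (-n D)`. -/
theorem sum_channel_condTypeClass_le {X Y : Type*} [Fintype X] [Fintype Y] [DecidableEq X]
    [DecidableEq Y] {n : ℕ} (hn : n ≠ 0) (W : X → Y → ℝ) (hW : ∀ x y, 0 ≤ W x y)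
    (x : Fin n → X) (y : Fin n → Y) (hsupp : ∀ a b, W a b = 0 → jointType x y (a, b) = 0) :
    ∑ y' ∈ univ.filter (fun y' : Fin n → Y => jointType x y' = jointType x y),
        ∏ i, W (x i) (y' i)
      ≤ Real.exp (-(n * ∑ a, ∑ b, jointType x y (a, b) * Real.log (jointType x y (a, b) /
          (push Prod.fst (jointType x y) a * W a b)))) := by
  set N := univ.filter (fun y' : Fin n → Y => jointType x y' = jointType x y) with hN
  set D := ∑ a, ∑ b, jointType x y (a, b) * Real.log (jointType x y (a, b) /
          (push Prod.fst (jointType x y) a * W a b)) with hD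
  -- On the class, the factor `exp(nD)` turns the channel probability into the probability under the
  -- conditional type of `y` given `x`, whose total mass is 1.
  have hterm : ∀ y' ∈ N, Real.exp (n * D) * ∏ i, W (x i) (y' i)
      = ∏ i, (jointType y x (y' i, x i) / empirical x (x i)) := by
    intro y' hy'
    have hV : jointType x y' = jointType x y := by simpa [hN] using hy'
    have hpos : ∀ i, 0 < jointType x y (x i, y' i) := fun i => by
      rw [← hV]; exact empirical_pos (fun i => (x i, y' i)) i
    have hWpos : ∀ i, 0 < W (x i) (y' i) := fun i =>
      lt_of_le_of_ne (hW _ _) fun h => (hpos i).ne' (hsupp _ _ h.symm)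
    have hexp := prod_eq_exp_sum_empirical (fun i => (x i, y' i))
      (fun ab => jointType x y ab / (empirical x ab.1 * W ab.1 ab.2)) (by
        intro i
        have h1 := hpos i
        have h2 := hWpos i
        have h3 := empirical_pos x i
        positivity)
    have hD' : ∑ a, empirical (fun i => (x i, y' i)) a *
        Real.log (jointType x y a / (empirical x a.1 * W a.1 a.2)) = D := by
      rw [hD, push_fst_jointType, Fintype.sum_prod_type]
      change ∑ a, ∑ b, jointType x y' (a, b) * _ = _
      rw [hV]
    rw [hD'] at hexp
    rw [← hexp, ← Finset.prod_mul_distrib]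
    refine Finset.prod_congr rfl fun i _ => ?_
    have h2 := hWpos i
    have h3 := empirical_pos x i
    have h4 : jointType y x (y' i, x i) = jointType x y (x i, y' i) := by
      simp only [jointType, empirical, Prod.mk.injEq, and_comm]
    rw [h4]
    field_simp
  have hsum : Real.exp (n * D) * ∑ y' ∈ N, ∏ i, W (x i) (y' i) ≤ 1 := by
    rw [← sum_prod_condProb y x, Finset.mul_sum, Finset.sum_congr rfl hterm]
    refine Finset.sum_le_sum_of_subset_of_nonneg (Finset.subset_univ _) fun u' _ _ => ?_
    refine Finset.prod_nonneg fun i _ => ?_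
    exact div_nonneg ((empirical_mem_stdSimplex hn _).1 _) (empirical_pos x i).le
  rw [Real.exp_neg, ← one_div, le_div_iff₀ (Real.exp_pos _), mul_comm]
  exact hsum

/-! ### Continuity of information quantities and compactness -/

section Continuity

variable {α β X Y : Type*} [Fintype α] [Fintype β] [Fintype X] [Fintype Y]
  [DecidableEq α] [DecidableEq β] [DecidableEq X] [DecidableEq Y]

theorem continuous_push (f : α → β) : Continuous (push f : (α → ℝ) → β → ℝ) :=
  continuous_pi fun _ => continuous_finsetSum _ fun a _ => continuous_apply a

theorem push_fst_apply (V : α × β → ℝ) (a : α) : push Prod.fst V a = ∑ b, V (a, b) := by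
  simp only [push, Finset.sum_filter, Fintype.sum_prod_type]
  rw [Finset.sum_eq_single a] <;> simp +contextual

theorem push_snd_apply (V : α × β → ℝ) (b : β) : push Prod.snd V b = ∑ a, V (a, b) := by
  simp only [push, Finset.sum_filter, Fintype.sum_prod_type, Finset.sum_ite_eq',
    Finset.mem_univ, if_true]

/-- Rewrites a divergence through `Real.negMulLog`, which is continuous at 0, so that continuity no
longer meets quotients with vanishing denominators. By `hw`, the default value of `log 0` is always
multiplied by 0. -/
theorem sum_mul_log_div (V : α × β → ℝ) (hV : ∀ t, 0 ≤ V t) (w : α → β → ℝ)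
    (hw : ∀ a b, w a b = 0 → V (a, b) = 0) :
    ∑ a, ∑ b, V (a, b) * Real.log (V (a, b) / (push Prod.fst V a * w a b))
      = ∑ a, Real.negMulLog (push Prod.fst V a) - ∑ a, ∑ b, Real.negMulLog (V (a, b))
        - ∑ a, ∑ b, V (a, b) * Real.log (w a b) := by
  rw [← Finset.sum_sub_distrib, ← Finset.sum_sub_distrib]
  refine Finset.sum_congr rfl fun a _ => ?_
  have h1 : Real.negMulLog (push Prod.fst V a)
      = ∑ b, -(V (a, b) * Real.log (push Prod.fst V a)) := by
    rw [Real.negMulLog, neg_mul, Finset.sum_neg_distrib, ← Finset.sum_mul, ← push_fst_apply]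
  rw [h1, ← Finset.sum_sub_distrib, ← Finset.sum_sub_distrib]
  refine Finset.sum_congr rfl fun b _ => ?_
  by_cases h : V (a, b) = 0
  · simp [h]
  · have hp : push Prod.fst V a ≠ 0 := by
      rw [push_fst_apply]
      intro h0
      exact h ((Finset.sum_eq_zero_iff_of_nonneg fun b _ => hV _).1 h0 b (Finset.mem_univ b))
    have hw' : w a b ≠ 0 := fun h0 => h (hw a b h0)
    rw [Real.log_div h (mul_ne_zero hp hw'), Real.log_mul hp hw', Real.negMulLog]
    ring

theorem mutualInfo_eq (V : α × β → ℝ) (hV : ∀ t, 0 ≤ V t) :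
    mutualInfo V = ∑ a, Real.negMulLog (push Prod.fst V a)
      - ∑ a, ∑ b, Real.negMulLog (V (a, b)) + ∑ b, Real.negMulLog (push Prod.snd V b) := by
  have h : ∑ a, ∑ b, V (a, b) * Real.log (push Prod.snd V b)
      = - ∑ b, Real.negMulLog (push Prod.snd V b) := by
    rw [Finset.sum_comm, ← Finset.sum_neg_distrib]
    refine Finset.sum_congr rfl fun b _ => ?_
    rw [← Finset.sum_mul, ← push_snd_apply, Real.negMulLog]
    ring
  rw [mutualInfo, sum_mul_log_div V hV (fun _ b => push Prod.snd V b), h, sub_neg_eq_add]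
  intro a b h0
  rw [push_snd_apply] at h0
  exact (Finset.sum_eq_zero_iff_of_nonneg fun a _ => hV _).1 h0 a (Finset.mem_univ a)

theorem continuousOn_mutualInfo :
    ContinuousOn (mutualInfo : (α × β → ℝ) → ℝ) (stdSimplex ℝ (α × β)) := by
  have hc : Continuous fun V : α × β → ℝ => ∑ a, Real.negMulLog (push Prod.fst V a)
      - ∑ a, ∑ b, Real.negMulLog (V (a, b)) + ∑ b, Real.negMulLog (push Prod.snd V b) := by
    have h1 := continuous_push (Prod.fst : α × β → α)
    have h2 := continuous_push (Prod.snd : α × β → β)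
    have h3 := Real.continuous_negMulLog
    fun_prop
  exact hc.continuousOn.congr fun V hV => mutualInfo_eq V hV.1

theorem mutualInfo_push_swap (Q : α × β → ℝ) :
    mutualInfo (push Prod.swap Q) = mutualInfo Q := by
  have h : ∀ a b, push Prod.swap Q (b, a) = Q (a, b) := by
    intro a b
    simp only [push, Finset.sum_filter]
    rw [Finset.sum_eq_single (a, b)]
    · simp
    · rintro ⟨a', b'⟩ - hne
      rw [if_neg]
      rintro heq
      exact hne (Prod.swap_injective heq)
    · simp
  unfold mutualInfo
  rw [Finset.sum_comm]
  simp only [h, push_comp]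
  refine Finset.sum_congr rfl fun a _ => Finset.sum_congr rfl fun b _ => ?_
  rw [mul_comm (push _ Q b)]
  rfl

/-- The distributions on triples that satisfy the constraints of `tPrime` and have a finite
divergence from the channel. -/
def feasible (W : X → Y → ℝ) (q : (X × Y → ℝ) → ℝ) : Set (X × X × Y → ℝ) :=
  {V | V ∈ stdSimplex ℝ (X × X × Y) ∧ q (margXY V) ≤ q (margX'Y V) ∧
    ∀ x y, W x y = 0 → margXY V (x, y) = 0}

/-- The value of `Gam` on `feasible`. -/
def gamReal (R : ℝ) (W : X → Y → ℝ) (V : X × X × Y → ℝ) : ℝ :=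
  (∑ x, ∑ y, margXY V (x, y) *
    Real.log (margXY V (x, y) / (push Prod.fst (margXY V) x * W x y)))
  + max (infoX'_XY V - R) 0

theorem Gam_eq_gamReal {R : ℝ} {W : X → Y → ℝ} {V : X × X × Y → ℝ}
    (h : ∀ x y, W x y = 0 → margXY V (x, y) = 0) : Gam R W V = (gamReal R W V : EReal) := by
  rw [Gam, condDiv, if_pos h, ← EReal.coe_add, gamReal]

theorem Gam_eq_top {R : ℝ} {W : X → Y → ℝ} {V : X × X × Y → ℝ}
    (h : ¬ ∀ x y, W x y = 0 → margXY V (x, y) = 0) : Gam R W V = ⊤ := by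
  rw [Gam, condDiv, if_neg h, EReal.top_add_coe]

/-- For fixed `W`, finiteness of the divergence is a closed condition: `V` vanishes at the zeros of
`W`. The metric inequality is closed by continuity of `q`. -/
theorem isCompact_feasible (W : X → Y → ℝ) {q : (X × Y → ℝ) → ℝ}
    (hq : ContinuousOn q (stdSimplex ℝ (X × Y))) : IsCompact (feasible W q) := by
  have h1 : ContinuousOn (fun V : X × X × Y → ℝ => q (margXY V)) (stdSimplex ℝ (X × X × Y)) :=
    hq.comp (continuous_push _).continuousOn fun V hV => push_mem_stdSimplex _ hV
  have h2 : ContinuousOn (fun V : X × X × Y → ℝ => q (margX'Y V)) (stdSimplex ℝ (X × X × Y)) :=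
    hq.comp (continuous_push _).continuousOn fun V hV => push_mem_stdSimplex _ hV
  have hS : IsCompact (stdSimplex ℝ (X × X × Y)) := isCompact_stdSimplex ℝ _
  have hcl := hS.isClosed.isClosed_le h1 h2
  have hz : IsClosed {V : X × X × Y → ℝ | ∀ x y, W x y = 0 → margXY V (x, y) = 0} := by
    simp only [Set.ofPred_forall]
    refine isClosed_iInter fun x => isClosed_iInter fun y => isClosed_iInter fun _ => ?_
    exact isClosed_eq ((continuous_apply _).comp (continuous_push _)) continuous_const
  have hset : feasible W q = {V | V ∈ stdSimplex ℝ (X × X × Y) ∧ q (margXY V) ≤ q (margX'Y V)} ∩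
      {V : X × X × Y → ℝ | ∀ x y, W x y = 0 → margXY V (x, y) = 0} :=
    Set.ext fun V => and_assoc.symm
  rw [hset]
  exact hS.of_isClosed_subset (hcl.inter hz) fun V hV => hV.1.1

theorem continuousOn_gamReal (R : ℝ) (W : X → Y → ℝ) (q : (X × Y → ℝ) → ℝ) :
    ContinuousOn (gamReal R W) (feasible W q) := by
  refine ContinuousOn.add ?_ (ContinuousOn.sup (ContinuousOn.sub ?_ continuousOn_const)
    continuousOn_const)
  · have hm : Continuous (margXY : (X × X × Y → ℝ) → X × Y → ℝ) := continuous_push _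
    have hc : Continuous fun V : X × X × Y → ℝ =>
        ∑ a, Real.negMulLog (push Prod.fst (margXY V) a)
          - ∑ a, ∑ b, Real.negMulLog (margXY V (a, b))
          - ∑ a, ∑ b, margXY V (a, b) * Real.log (W a b) := by
      have h1 := continuous_push (Prod.fst : X × Y → X)
      have h3 := Real.continuous_negMulLog
      fun_prop
    exact hc.continuousOn.congr fun V hV =>
      sum_mul_log_div (margXY V) (push_mem_stdSimplex _ hV.1).1 W hV.2.2
  · exact continuousOn_mutualInfo.comp (continuous_push _).continuousOn
      fun V hV => push_mem_stdSimplex _ hV.1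

/-- If all distributions with both marginals equal to `P` and `β ≤ Δ` have mutual information at
least `r`, those with marginals close to `P` have mutual information at least almost `r`. -/
theorem exists_forall_le_mutualInfo (R : ℝ) (W : X → Y → ℝ) {q : (X × Y → ℝ) → ℝ}
    (hq : ContinuousOn q (stdSimplex ℝ (X × Y))) (P : X → ℝ) (Δ r : ℝ)
    (hr : ∀ Q ∈ stdSimplex ℝ (X × X), push Prod.fst Q = P → push Prod.snd Q = P →
      betaDist R W q Q ≤ (Δ : EReal) → r ≤ mutualInfo Q) {η : ℝ} (hη : 0 < η) :
    ∃ k : ℕ, ∀ Q ∈ stdSimplex ℝ (X × X),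
      (∀ a, |push Prod.fst Q a - P a| ≤ 1 / ((k : ℝ) + 1)) →
      (∀ a, |push Prod.snd Q a - P a| ≤ 1 / ((k : ℝ) + 1)) →
      betaDist R W q Q ≤ (Δ : EReal) → r - η ≤ mutualInfo Q := by
  by_contra hcon
  push Not at hcon
  choose Q hQ h1 h2 hβ hI using hcon
  -- Attainment of the infimum is not needed: a triple distribution within `1/(k+1)` of `Δ`
  -- suffices, and the excess vanishes in the limit. The limit triple gives a pair distribution with
  -- marginals exactly `P`, `β ≤ Δ`, and mutual information at most `r - η`.
  have hVex : ∀ k, ∃ V ∈ feasible W q, margXX V = Q k ∧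
      gamReal R W V ≤ Δ + 1 / ((k : ℝ) + 1) := by
    intro k
    have hlt : betaDist R W q (Q k) < ((Δ + 1 / ((k : ℝ) + 1) : ℝ) : EReal) :=
      (hβ k).trans_lt (EReal.coe_lt_coe_iff.2 (by
        have : (0 : ℝ) < 1 / ((k : ℝ) + 1) := by positivity
        linarith))
    simp only [betaDist, iInf_lt_iff] at hlt
    obtain ⟨V, hV, hG⟩ := hlt
    have hs : ∀ x y, W x y = 0 → margXY V (x, y) = 0 := by
      by_contra hs
      rw [Gam_eq_top hs] at hG
      exact not_top_lt hG
    rw [Gam_eq_gamReal hs, EReal.coe_lt_coe_iff] at hG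
    exact ⟨V, ⟨hV.1, hV.2.2, hs⟩, hV.2.1, hG.le⟩
  choose V hV hVQ hG using hVex
  obtain ⟨V₀, hV₀, φ, hφ, hlim⟩ := (isCompact_feasible W hq).tendsto_subseq hV
  have hlim' : Tendsto (V ∘ φ) atTop (𝓝[feasible W q] V₀) :=
    tendsto_nhdsWithin_iff.2 ⟨hlim, Eventually.of_forall fun k => hV _⟩
  have hinv : Tendsto (fun k => 1 / ((φ k : ℝ) + 1)) atTop (𝓝 0) :=
    tendsto_one_div_add_atTop_nhds_zero_nat.comp hφ.tendsto_atTop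
  have hQlim : Tendsto (Q ∘ φ) atTop (𝓝 (margXX V₀)) := by
    have := ((continuous_push (fun t : X × X × Y => (t.1, t.2.1))).tendsto V₀).comp hlim
    refine this.congr fun k => ?_
    exact hVQ (φ k)
  have hmem : margXX V₀ ∈ stdSimplex ℝ (X × X) := push_mem_stdSimplex _ hV₀.1
  have hmarg : ∀ f : X × X → X,
      (∀ k a, |push f (Q k) a - P a| ≤ 1 / ((k : ℝ) + 1)) → push f (margXX V₀) = P := by
    intro f hf
    funext a
    have ht : Tendsto (fun k => |push f (Q (φ k)) a - P a|) atTop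
        (𝓝 |push f (margXX V₀) a - P a|) :=
      ((((continuous_apply a).comp (continuous_push f)).tendsto _).comp hQlim).sub_const _ |>.abs
    have := le_of_tendsto_of_tendsto' ht hinv fun k => hf (φ k) a
    exact sub_eq_zero.1 (abs_nonpos_iff.1 this)
  have hGlim : gamReal R W V₀ ≤ Δ := by
    have ht := ((continuousOn_gamReal R W q).continuousWithinAt hV₀).tendsto.comp hlim'
    have h := le_of_tendsto_of_tendsto' ht (hinv.const_add Δ) fun k => hG (φ k)
    simpa using h
  have hβ₀ : betaDist R W q (margXX V₀) ≤ (Δ : EReal) := by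
    refine (iInf₂_le V₀ ⟨hV₀.1, rfl, hV₀.2.1⟩).trans ?_
    rw [Gam_eq_gamReal hV₀.2.2]
    exact EReal.coe_le_coe_iff.2 hGlim
  have hr₀ := hr _ hmem (hmarg _ h1) (hmarg _ h2) hβ₀
  have hQlim' : Tendsto (Q ∘ φ) atTop (𝓝[stdSimplex ℝ (X × X)] (margXX V₀)) :=
    tendsto_nhdsWithin_iff.2 ⟨hQlim, Eventually.of_forall fun k => hQ _⟩
  have hIlim := (continuousOn_mutualInfo.continuousWithinAt hmem).tendsto.comp hQlim'
  have := le_of_tendsto' hIlim fun k => (hI (φ k)).le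
  linarith

end Continuity

/-! ### The random codebook -/

/-- A sum of products of causal factors is bounded by the product of bounds on the sums of the
factors over their last argument. -/
theorem sum_prod_le_prod_of_causal {A : Type*} [Fintype A] [DecidableEq A] :
    ∀ (M : ℕ) (κ : Fin M → (Fin M → A) → ℝ) (b : Fin M → ℝ),
    (∀ i c, 0 ≤ κ i c) → (∀ i, 0 ≤ b i) →
    (∀ i c c', (∀ j ≤ i, c j = c' j) → κ i c = κ i c') →
    (∀ i c, ∑ a, κ i (Function.update c i a) ≤ b i) →
    ∑ c, ∏ i, κ i c ≤ ∏ i, b i := by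
  intro M
  induction M with
  | zero => intro κ b _ _ _ _; simp
  | succ M ih =>
    intro κ b hκ hb hdep hsum
    rw [← (Fin.consEquiv (fun _ : Fin (M + 1) => A)).sum_comp, Fintype.sum_prod_type,
      Fin.prod_univ_succ]
    have hhead : ∀ a (c : Fin M → A),
        κ 0 (Fin.cons a c : Fin (M + 1) → A) = κ 0 (fun _ => a) := fun a c =>
      hdep _ _ _ fun j hj => by
        obtain rfl : j = 0 := Fin.le_zero_iff.1 hj
        rfl
    have htail : ∀ a, ∑ c : Fin M → A, ∏ i : Fin M, κ i.succ (Fin.cons a c : Fin (M + 1) → A)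
        ≤ ∏ i : Fin M, b i.succ := fun a => by
      refine ih (fun i c => κ i.succ (Fin.cons a c : Fin (M + 1) → A)) (fun i => b i.succ)
        (fun i c => hκ _ _) (fun i => hb _) ?_ ?_
      · intro i c c' h
        refine hdep _ _ _ fun j hj => ?_
        rcases Fin.eq_zero_or_eq_succ j with rfl | ⟨j, rfl⟩
        · rfl
        · simpa using h j (Fin.succ_le_succ_iff.1 hj)
      · intro i c
        have := hsum i.succ (Fin.cons a c : Fin (M + 1) → A)
        simpa only [Fin.cons_update] using this
    have hsum0 : ∑ a, κ 0 (fun _ => a) ≤ b 0 := by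
      -- The hypothesis `hsum` modifies an existing sequence, so it says nothing when `A` is empty.
      rcases isEmpty_or_nonempty A with hA | ⟨⟨a₀⟩⟩
      · simpa using hb 0
      · refine le_trans (le_of_eq ?_) (hsum 0 (fun _ => a₀))
        refine Finset.sum_congr rfl fun a _ => hdep _ _ _ fun j hj => ?_
        obtain rfl : j = 0 := Fin.le_zero_iff.1 hj
        simp
    calc ∑ a, ∑ c : Fin M → A, ∏ i, κ i (Fin.consEquiv (fun _ : Fin (M + 1) => A) (a, c))
        = ∑ a, κ 0 (fun _ => a) *
            ∑ c : Fin M → A, ∏ i : Fin M, κ i.succ (Fin.cons a c : Fin (M + 1) → A) := by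
          refine Finset.sum_congr rfl fun a _ => ?_
          rw [Finset.mul_sum]
          refine Finset.sum_congr rfl fun c _ => ?_
          rw [Fin.prod_univ_succ]
          congr 1
          exact hhead a c
      _ ≤ ∑ a, κ 0 (fun _ => a) * ∏ i : Fin M, b i.succ :=
          Finset.sum_le_sum fun a _ => mul_le_mul_of_nonneg_left (htail a) (hκ _ _)
      _ = (∑ a, κ 0 (fun _ => a)) * ∏ i : Fin M, b i.succ := by rw [Finset.sum_mul]
      _ ≤ _ := mul_le_mul_of_nonneg_right hsum0 (Finset.prod_nonneg fun i _ => hb _)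

section Codebook

variable {X : Type*} [Fintype X] [DecidableEq X] {n M : ℕ} {p : X → ℝ}
  {d : (X × X → ℝ) → EReal} {Δ : ℝ}

theorem mem_available {c : Fin M → Fin n → X} {i : Fin M} {z : Fin n → X} :
    z ∈ available p d Δ c i ↔
      z ∈ typeClass n p ∧ ∀ j < i, (Δ : EReal) < d (jointType z (c j)) := by
  simp [available]

theorem available_congr {c c' : Fin M → Fin n → X} {i : Fin M} (h : ∀ j < i, c j = c' j) :
    available p d Δ c i = available p d Δ c' i := by
  ext z
  simp only [mem_available]
  refine and_congr_right fun _ => forall₂_congr fun j hj => ?_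
  rw [h j hj]

theorem codebookProb_nonneg (c : Fin M → Fin n → X) : 0 ≤ codebookProb p d Δ c := by
  unfold codebookProb
  exact Finset.prod_nonneg fun i _ => by split_ifs <;> positivity

theorem mem_available_of_codebookProb_ne_zero {c : Fin M → Fin n → X}
    (h : codebookProb p d Δ c ≠ 0) (i : Fin M) : c i ∈ available p d Δ c i := by
  by_contra hi
  refine h (Finset.prod_eq_zero (Finset.mem_univ i) ?_)
  rw [if_neg hi]

open Classical in
/-- If every draw is from at least half of the type class, prescribed values of the codewords in
`s` have probability at most `(2 / |𝒯(p)|) ^ |s|`. -/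
theorem sum_codebookProb_le (hT : (typeClass n p).Nonempty)
    (hcard : ∀ (c : Fin M → Fin n → X) (i : Fin M), (∀ j < i, c j ∈ typeClass n p) →
      ((typeClass n p).card : ℝ) ≤ 2 * (available p d Δ c i).card)
    (s : Finset (Fin M)) (x : Fin M → Fin n → X) :
    ∑ c ∈ univ.filter (fun c : Fin M → Fin n → X => ∀ i ∈ s, c i = x i), codebookProb p d Δ c
      ≤ (2 / ((typeClass n p).card : ℝ)) ^ s.card := by
  have hT0 : (0 : ℝ) < (typeClass n p).card := Nat.cast_pos.2 (Finset.card_pos.2 hT)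
  -- Each factor also records that the past lies in the type class, which `hcard` requires and which
  -- is automatic for codebooks of nonzero probability, and that the prescribed value is taken. All
  -- of this depends only on `c j` with `j ≤ i`, so the factors are causal.
  set κ : Fin M → (Fin M → Fin n → X) → ℝ := fun i c =>
    if c i ∈ available p d Δ c i ∧ (∀ j < i, c j ∈ typeClass n p) ∧ (i ∈ s → c i = x i)
    then 1 / ((available p d Δ c i).card : ℝ) else 0 with hκ
  set b : Fin M → ℝ := fun i => if i ∈ s then 2 / ((typeClass n p).card : ℝ) else 1 with hb
  have hκ0 : ∀ i c, 0 ≤ κ i c := fun i c => by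
    simp only [hκ]; split_ifs <;> positivity
  have hb0 : ∀ i, 0 ≤ b i := fun i => by
    simp only [hb]; split_ifs <;> positivity
  have hprod : ∏ i, b i = (2 / ((typeClass n p).card : ℝ)) ^ s.card := by
    simp only [hb, Finset.prod_ite_mem, Finset.univ_inter, Finset.prod_const]
  rw [← hprod]
  refine le_trans ?_ (sum_prod_le_prod_of_causal M κ b hκ0 hb0 ?_ ?_)
  · refine (Finset.sum_le_sum fun c hc => ?_).trans
      (Finset.sum_le_sum_of_subset_of_nonneg (Finset.filter_subset _ _)
        fun c _ _ => Finset.prod_nonneg fun i _ => hκ0 i c)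
    have hc' : ∀ i ∈ s, c i = x i := by simpa using hc
    by_cases h : codebookProb p d Δ c = 0
    · rw [h]; exact Finset.prod_nonneg fun i _ => hκ0 i c
    · have hav := mem_available_of_codebookProb_ne_zero h
      refine le_of_eq (Finset.prod_congr rfl fun i _ => ?_)
      simp only [hκ]
      rw [if_pos (hav i), if_pos ⟨hav i, fun j _ => (mem_available.1 (hav j)).1, hc' i⟩]
  · intro i c c' h
    have h' : available p d Δ c i = available p d Δ c' i :=
      available_congr fun j hj => h j hj.le
    have h2 : (∀ j < i, c j ∈ typeClass n p) ↔ (∀ j < i, c' j ∈ typeClass n p) :=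
      forall₂_congr fun j hj => by rw [h j hj.le]
    simp only [hκ]
    rw [h', h i le_rfl]
    simp only [h2]
  · intro i c
    have hav : ∀ a, available p d Δ (Function.update c i a) i = available p d Δ c i := fun a =>
      available_congr fun j hj => Function.update_of_ne hj.ne _ _
    have hpast : ∀ a, (∀ j < i, Function.update c i a j ∈ typeClass n p) ↔
        ∀ j < i, c j ∈ typeClass n p := fun a =>
      forall₂_congr fun j hj => by rw [Function.update_of_ne hj.ne]
    simp only [hκ, hav, hpast, Function.update_self]
    by_cases hp : ∀ j < i, c j ∈ typeClass n p
    · have hc := hcard c i hp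
      have hA0 : (0 : ℝ) < (available p d Δ c i).card := by linarith
      by_cases hi : i ∈ s
      · calc _ ≤ ∑ a, if a = x i then 1 / ((available p d Δ c i).card : ℝ) else 0 := by
              refine Finset.sum_le_sum fun a _ => ?_
              by_cases ha : a = x i
              · rw [if_pos ha]
                split_ifs
                · exact le_rfl
                · positivity
              · rw [if_neg ha, if_neg (fun h => ha (h.2.2 hi))]
          _ = 1 / ((available p d Δ c i).card : ℝ) := by simp
          _ ≤ b i := by
              simp only [hb, if_pos hi]
              rw [div_le_div_iff₀ hA0 hT0]
              linarith
      · simp only [hb, if_neg hi]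
        have : ∀ a, (a ∈ available p d Δ c i ∧ (∀ j < i, c j ∈ typeClass n p) ∧
            (i ∈ s → a = x i)) ↔ a ∈ available p d Δ c i := fun a =>
          ⟨fun h => h.1, fun h => ⟨h, hp, fun h' => absurd h' hi⟩⟩
        simp only [this]
        rw [Finset.sum_ite_mem, Finset.univ_inter, Finset.sum_const, nsmul_eq_mul,
          mul_one_div_cancel hA0.ne']
    · have : ∀ a, ¬ (a ∈ available p d Δ c i ∧ (∀ j < i, c j ∈ typeClass n p) ∧
          (i ∈ s → a = x i)) := fun a h => hp h.2.1
      simp only [this, if_false, Finset.sum_const_zero]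
      exact hb0 i

end Codebook

/-! ### The volume condition -/

theorem eventually_mul_pow_le_exp (C : ℝ) (k : ℕ) {ε : ℝ} (hε : 0 < ε) :
    ∀ᶠ n : ℕ in atTop, C * (Real.exp 1 * (n + 1)) ^ k ≤ Real.exp (n * ε) := by
  have h := isLittleO_pow_const_const_pow_of_one_lt (R := ℝ) k (Real.one_lt_exp_iff.2 hε)
  set K := |C| * (2 * Real.exp 1) ^ k + 1 with hK
  have hK0 : 0 < K := by positivity
  filter_upwards [h.bound (inv_pos.2 hK0), eventually_ge_atTop 1] with n hn hn1
  rw [Real.norm_of_nonneg (by positivity), Real.norm_of_nonneg (by positivity),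
    ← Real.exp_nat_mul, inv_mul_eq_div, le_div_iff₀ hK0] at hn
  refine le_trans ?_ hn
  have hn1' : (1 : ℝ) ≤ n := by exact_mod_cast hn1
  calc C * (Real.exp 1 * (n + 1)) ^ k ≤ |C| * (2 * Real.exp 1 * n) ^ k := by
        have : Real.exp 1 * ((n : ℝ) + 1) ≤ 2 * Real.exp 1 * n := by
          nlinarith [Real.exp_pos 1]
        gcongr
        exact le_abs_self C
    _ = (n : ℝ) ^ k * (|C| * (2 * Real.exp 1) ^ k) := by rw [mul_pow]; ring
    _ ≤ (n : ℝ) ^ k * K := by gcongr; linarith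

section Volume

variable {X : Type*} [Fintype X] [DecidableEq X]

/-- The construction controls the distance from a later codeword to an earlier one; symmetry makes
the order of drawing irrelevant. -/
theorem symmetrize_jointType_comm (d : (X × X → ℝ) → EReal) {n : ℕ} (x x' : Fin n → X) :
    symmetrize d (jointType x x') = symmetrize d (jointType x' x) := by
  rw [symmetrize, symmetrize, push_swap_jointType, push_swap_jointType, min_comm]

-- The ball is split by joint type, each piece lying in a conditional type class. A small
-- symmetrized distance means that `d` is small at the joint type or at its swap; both have
-- marginals `p` and the same mutual information, so `hr` applies to either.
open Classical in
theorem card_ball_le {n : ℕ} (hn : n ≠ 0) {p : X → ℝ} {d : (X × X → ℝ) → EReal} {Δ r : ℝ}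
    (hr : ∀ Q ∈ stdSimplex ℝ (X × X), push Prod.fst Q = p → push Prod.snd Q = p →
      d Q ≤ (Δ : EReal) → r ≤ mutualInfo Q) (x : Fin n → X) (hx : x ∈ typeClass n p) :
    (((typeClass n p).filter
        (fun z => symmetrize d (jointType z x) ≤ (Δ : EReal))).card : ℝ)
      ≤ polyFactor (X × X) n *
        (polyFactor X n * (typeClass n p).card * Real.exp (-(n * r))) := by
  set S := (typeClass n p).filter (fun z => symmetrize d (jointType z x) ≤ (Δ : EReal)) with hS
  have hx' := mem_typeClass.1 hx
  have hcard : S.card = ∑ Q ∈ types (X × X) n, (S.filter (fun z => jointType z x = Q)).card :=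
    Finset.card_eq_sum_card_fiberwise fun z _ =>
      Finset.mem_coe.2 (Finset.mem_image_of_mem _ (Finset.mem_univ _))
  have hterm : ∀ Q ∈ types (X × X) n, ((S.filter (fun z => jointType z x = Q)).card : ℝ)
      ≤ polyFactor X n * (typeClass n p).card * Real.exp (-(n * r)) := by
    intro Q _
    have hpoly := polyFactor_pos X n
    rcases (S.filter (fun z => jointType z x = Q)).eq_empty_or_nonempty with h | ⟨z, hz⟩
    · rw [h]; simp only [Finset.card_empty, Nat.cast_zero]; positivity
    · simp only [hS, Finset.mem_filter, mem_typeClass] at hz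
      obtain ⟨⟨hzT, hzd⟩, rfl⟩ := hz
      have hI : r ≤ mutualInfo (jointType z x) := by
        rcases min_le_iff.1 hzd with h | h
        · exact hr _ (empirical_mem_stdSimplex hn _) (by rw [push_fst_jointType, hzT])
            (by rw [push_snd_jointType, hx']) h
        · rw [← mutualInfo_push_swap]
          rw [push_swap_jointType] at h ⊢
          exact hr _ (empirical_mem_stdSimplex hn _) (by rw [push_fst_jointType, hx'])
            (by rw [push_snd_jointType, hzT]) h
      have h1 := card_condTypeClass_le hn z x
      rw [hzT] at h1
      calc ((S.filter (fun z' => jointType z' x = jointType z x)).card : ℝ)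
          ≤ ((univ.filter (fun z' : Fin n → X => jointType z' x = jointType z x)).card : ℝ) := by
            exact_mod_cast Finset.card_le_card (Finset.filter_subset_filter _ (Finset.subset_univ _))
        _ ≤ _ := h1
        _ ≤ _ := by gcongr
  rw [hcard, Nat.cast_sum]
  refine (Finset.sum_le_sum hterm).trans ?_
  rw [Finset.sum_const, nsmul_eq_mul]
  have hpoly := polyFactor_pos X n
  exact mul_le_mul_of_nonneg_right (card_types_le n) (by positivity)

/-- Since `exp(nδ) ≥ 2`, each ball around an earlier codeword fills at most a fraction `1/(2M)` of
the type class, and there are at most `M` of them. -/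
theorem VolumeCondition.card_le_two_mul_card_available {n M : ℕ} {p : X → ℝ}
    {d : (X × X → ℝ) → EReal} {Δ δ : ℝ} (h : VolumeCondition n M p d Δ δ)
    (hδ : 2 ≤ Real.exp (n * δ)) (c : Fin M → Fin n → X) (i : Fin M)
    (hc : ∀ j < i, c j ∈ typeClass n p) :
    ((typeClass n p).card : ℝ) ≤ 2 * (available p d Δ c i).card := by
  classical
  have hM : (0 : ℝ) < M := Nat.cast_pos.2 i.pos
  set B : Fin M → Finset (Fin n → X) := fun j =>
    (typeClass n p).filter (fun z => d (jointType z (c j)) ≤ (Δ : EReal)) with hB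
  have hcover : typeClass n p ⊆ available p d Δ c i ∪ (univ.filter (· < i)).biUnion B := by
    intro z hz
    by_cases hav : z ∈ available p d Δ c i
    · exact Finset.mem_union_left _ hav
    · refine Finset.mem_union_right _ ?_
      rw [mem_available] at hav
      push Not at hav
      obtain ⟨j, hj, hd⟩ := hav hz
      exact Finset.mem_biUnion.2 ⟨j, by simpa using hj, Finset.mem_filter.2 ⟨hz, hd⟩⟩
  have h1 : ((typeClass n p).card : ℝ)
      ≤ (available p d Δ c i).card + ∑ j ∈ univ.filter (· < i), ((B j).card : ℝ) := by
    exact_mod_cast (Finset.card_le_card hcover).trans ((Finset.card_union_le _ _).trans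
      (Nat.add_le_add_left Finset.card_biUnion_le _))
  have h2 : ∀ j ∈ univ.filter (· < i),
      ((B j).card : ℝ) ≤ (typeClass n p).card / (2 * M) := by
    intro j hj
    have hv := h (c j) (hc j (by simpa using hj))
    rw [le_div_iff₀ (by positivity)]
    refine le_trans ?_ hv
    have : (0 : ℝ) ≤ M * (B j).card := by positivity
    calc ((B j).card : ℝ) * (2 * M) = 2 * (M * (B j).card) := by ring
      _ ≤ Real.exp (n * δ) * (M * (B j).card) := by gcongr
      _ = M * Real.exp (n * δ) * (B j).card := by ring
      _ = _ := by simp only [hB]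
  have h3 : ∑ j ∈ univ.filter (· < i), ((B j).card : ℝ) ≤ (typeClass n p).card / 2 := by
    calc _ ≤ ∑ j ∈ univ.filter (· < i), ((typeClass n p).card : ℝ) / (2 * M) :=
          Finset.sum_le_sum h2
      _ ≤ ∑ _j : Fin M, ((typeClass n p).card : ℝ) / (2 * M) :=
          Finset.sum_le_sum_of_subset_of_nonneg (Finset.subset_univ _) fun _ _ _ => by positivity
      _ = _ := by
          rw [Finset.sum_const, Finset.card_univ, Fintype.card_fin, nsmul_eq_mul]
          field_simp
  linarith

theorem VolumeCondition.neverStuck {n M : ℕ} {p : X → ℝ}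
    {d : (X × X → ℝ) → EReal} {Δ δ : ℝ} (h : VolumeCondition n M p d Δ δ)
    (hδ : 2 ≤ Real.exp (n * δ)) (hT : (typeClass n p).Nonempty) :
    NeverStuck n M p d Δ := by
  intro c i hc
  have h1 := h.card_le_two_mul_card_available hδ c i fun j hj => (mem_available.1 (hc j hj)).1
  have h2 : (0 : ℝ) < (typeClass n p).card := Nat.cast_pos.2 (Finset.card_pos.2 hT)
  rw [← Finset.card_pos, ← Nat.cast_pos (α := ℝ)]
  linarith

end Volume

/-! ### The error probability -/

/-- Truncation at 1 is subadditive, so the truncated union bound can be split over joint types. -/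
theorem min_one_sum_le {ι : Type*} (s : Finset ι) (a : ι → ℝ) (ha : ∀ i, 0 ≤ a i) :
    min 1 (∑ i ∈ s, a i) ≤ ∑ i ∈ s, min 1 (a i) := by
  have h0 : ∀ i ∈ s, 0 ≤ min 1 (a i) := fun i _ => le_min zero_le_one (ha i)
  by_cases h : ∃ i ∈ s, 1 ≤ a i
  · obtain ⟨i, hi, h1⟩ := h
    calc min 1 (∑ i ∈ s, a i) ≤ 1 := min_le_left _ _
      _ = min 1 (a i) := (min_eq_left h1).symm
      _ ≤ _ := Finset.single_le_sum h0 hi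
  · push Not at h
    refine (min_le_right _ _).trans (Finset.sum_le_sum fun i hi => ?_)
    rw [min_eq_right (h i hi).le]

section ErrorProbability

variable {X Y : Type*} [Fintype X] [Fintype Y] [DecidableEq X] [DecidableEq Y] {n M : ℕ}

open Classical in
/-- The sequences of type `p` at distance more than `Δ` from `x` that the decoder does not rank
below `x` when `y` is received. -/
def confusable (p : X → ℝ) (d : (X × X → ℝ) → EReal) (Δ : ℝ) (q : (X × Y → ℝ) → ℝ)
    (x : Fin n → X) (y : Fin n → Y) : Finset (Fin n → X) :=
  (typeClass n p).filter
    (fun x' => (Δ : EReal) < d (jointType x x') ∧ q (jointType x y) ≤ q (jointType x' y))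

theorem mem_confusable {p : X → ℝ} {d : (X × X → ℝ) → EReal} {Δ : ℝ} {q : (X × Y → ℝ) → ℝ}
    {x x' : Fin n → X} {y : Fin n → Y} : x' ∈ confusable p d Δ q x y ↔ x' ∈ typeClass n p ∧
      (Δ : EReal) < d (jointType x x') ∧ q (jointType x y) ≤ q (jointType x' y) := by
  simp [confusable]

-- The first term of the minimum is the probability of the event `c m = x` alone. The second is a
-- union bound over the rival index and its value in `confusable`, each pair of values having
-- probability at most `(2/T)^2`. Keeping both is what later produces the positive part `|I - R|₊`.
open Classical in
theorem sum_codebookProb_confused_le {p : X → ℝ} {d : (X × X → ℝ) → EReal} {Δ : ℝ}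
    (q : (X × Y → ℝ) → ℝ) (hT : (typeClass n p).Nonempty)
    (hd : ∀ x x' : Fin n → X, d (jointType x x') = d (jointType x' x))
    (hcard : ∀ (c : Fin M → Fin n → X) (i : Fin M), (∀ j < i, c j ∈ typeClass n p) →
      ((typeClass n p).card : ℝ) ≤ 2 * (available p d Δ c i).card)
    (m : Fin M) (x : Fin n → X) (y : Fin n → Y) :
    ∑ c ∈ univ.filter (fun c : Fin M → Fin n → X => c m = x),
        (if ∃ i, i ≠ m ∧ q (jointType (c m) y) ≤ q (jointType (c i) y) then
          codebookProb p d Δ c else 0)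
      ≤ 2 / ((typeClass n p).card : ℝ) *
        min 1 (2 * M * (confusable p d Δ q x y).card / ((typeClass n p).card : ℝ)) := by
  have hT0 : (0 : ℝ) < (typeClass n p).card := Nat.cast_pos.2 (Finset.card_pos.2 hT)
  set T : ℝ := ((typeClass n p).card : ℝ) with hTdef
  set S := confusable p d Δ q x y with hS
  rw [mul_min_of_nonneg _ _ (by positivity)]
  refine le_min ?_ ?_
  · have h := sum_codebookProb_le hT hcard {m} (fun _ => x)
    simp only [Finset.mem_singleton, forall_eq, Finset.card_singleton, pow_one] at h
    rw [mul_one]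
    refine le_trans (Finset.sum_le_sum fun c _ => ?_) h
    split_ifs
    · exact le_rfl
    · exact codebookProb_nonneg c
  -- Prescribes `x` at `m` and `x'` elsewhere; only the indices `m` and `i` are ever consulted.
  · set f : (Fin n → X) → Fin M → Fin n → X := fun x' k => if k = m then x else x' with hf
    have hpair : ∀ i ∈ univ.erase m, ∀ x' ∈ S,
        ∑ c ∈ univ.filter (fun c : Fin M → Fin n → X => ∀ k ∈ ({m, i} : Finset (Fin M)),
          c k = f x' k), codebookProb p d Δ c ≤ (2 / T) ^ 2 := by
      intro i hi x' _
      have h := sum_codebookProb_le hT hcard {m, i} (f x')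
      rwa [Finset.card_pair (Finset.ne_of_mem_erase hi).symm] at h
    calc _ ≤ ∑ c : Fin M → Fin n → X, ∑ i ∈ univ.erase m, ∑ x' ∈ S,
          (if ∀ k ∈ ({m, i} : Finset (Fin M)), c k = f x' k then codebookProb p d Δ c else 0) := by
          have hnn : ∀ (c : Fin M → Fin n → X) (i : Fin M) (x' : Fin n → X),
              0 ≤ (if ∀ k ∈ ({m, i} : Finset (Fin M)), c k = f x' k then
                codebookProb p d Δ c else 0) := fun c i x' => by
            split_ifs
            · exact codebookProb_nonneg c
            · exact le_rfl
          have hnn2 : ∀ (c : Fin M → Fin n → X) (i : Fin M), 0 ≤ ∑ x' ∈ S,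
              (if ∀ k ∈ ({m, i} : Finset (Fin M)), c k = f x' k then
                codebookProb p d Δ c else 0) := fun c i => Finset.sum_nonneg fun x' _ => hnn c i x'
          have hnn3 : ∀ c : Fin M → Fin n → X, 0 ≤ ∑ i ∈ univ.erase m, ∑ x' ∈ S,
              (if ∀ k ∈ ({m, i} : Finset (Fin M)), c k = f x' k then
                codebookProb p d Δ c else 0) := fun c => Finset.sum_nonneg fun i _ => hnn2 c i
          refine (Finset.sum_le_sum fun c hc => ?_).trans
            (Finset.sum_le_sum_of_subset_of_nonneg (Finset.filter_subset _ _) fun c _ _ => hnn3 c)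
          have hcm : c m = x := (Finset.mem_filter.1 hc).2
          by_cases h0 : codebookProb p d Δ c = 0
          · rw [h0, ite_self]
            exact le_of_eq_of_le rfl (by simp)
          by_cases hE : ∃ i, i ≠ m ∧ q (jointType (c m) y) ≤ q (jointType (c i) y)
          · rw [if_pos hE]
            obtain ⟨i, him, hq⟩ := hE
            have hav := mem_available_of_codebookProb_ne_zero h0
            have hSi : c i ∈ S := by
              rw [hS, mem_confusable, ← hcm]
              refine ⟨(mem_available.1 (hav i)).1, ?_, hq⟩
              -- Whichever of the two codewords was drawn later guarantees the separation.
              rcases lt_or_gt_of_ne him with hlt | hlt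
              · exact (mem_available.1 (hav m)).2 i hlt
              · rw [hd]; exact (mem_available.1 (hav i)).2 m hlt
            have hk : ∀ k ∈ ({m, i} : Finset (Fin M)), c k = f (c i) k := by
              intro k hk
              rcases Finset.mem_insert.1 hk with rfl | hk
              · simp [hf, hcm]
              · rw [Finset.mem_singleton] at hk
                subst hk
                simp [hf, him]
            calc codebookProb p d Δ c
                = (if ∀ k ∈ ({m, i} : Finset (Fin M)), c k = f (c i) k then
                  codebookProb p d Δ c else 0) := by rw [if_pos hk]
              _ ≤ _ := Finset.single_le_sum (f := fun x' =>
                  if ∀ k ∈ ({m, i} : Finset (Fin M)), c k = f x' k then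
                    codebookProb p d Δ c else 0) (fun x' _ => hnn c i x') hSi
              _ ≤ _ := Finset.single_le_sum (f := fun i => ∑ x' ∈ S,
                  if ∀ k ∈ ({m, i} : Finset (Fin M)), c k = f x' k then
                    codebookProb p d Δ c else 0) (fun i _ => hnn2 c i)
                    (Finset.mem_erase.2 ⟨him, Finset.mem_univ i⟩)
          · rw [if_neg hE]; exact hnn3 c
      _ = ∑ i ∈ univ.erase m, ∑ x' ∈ S, ∑ c ∈ univ.filter (fun c : Fin M → Fin n → X =>
            ∀ k ∈ ({m, i} : Finset (Fin M)), c k = f x' k), codebookProb p d Δ c := by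
          rw [Finset.sum_comm]
          refine Finset.sum_congr rfl fun i _ => ?_
          rw [Finset.sum_comm]
          refine Finset.sum_congr rfl fun x' _ => ?_
          rw [Finset.sum_filter]
      _ ≤ ∑ i ∈ univ.erase m, ∑ x' ∈ S, (2 / T) ^ 2 :=
          Finset.sum_le_sum fun i hi => Finset.sum_le_sum fun x' hx' => hpair i hi x' hx'
      _ ≤ ∑ i : Fin M, ∑ x' ∈ S, (2 / T) ^ 2 :=
          Finset.sum_le_sum_of_subset_of_nonneg (Finset.subset_univ _) fun _ _ _ => by positivity
      _ = 2 / T * (2 * M * S.card / T) := by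
          simp only [Finset.sum_const, Finset.card_univ, Fintype.card_fin, nsmul_eq_mul]
          ring

theorem prod_eq_zero_of_jointType {W : X → Y → ℝ} {x : Fin n → X} {y : Fin n → Y} {a : X} {b : Y}
    (hW : W a b = 0) (h : jointType x y (a, b) ≠ 0) : ∏ k, W (x k) (y k) = 0 := by
  have : occ (fun i => (x i, y i)) (a, b) ≠ 0 := fun h0 => h (by
    rw [jointType, empirical_apply, h0]; simp)
  obtain ⟨i, hi⟩ := Finset.card_pos.1 (Nat.pos_of_ne_zero this)
  have hi' : x i = a ∧ y i = b := by simpa using hi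
  exact Finset.prod_eq_zero (Finset.mem_univ i) (by rw [hi'.1, hi'.2, hW])

theorem one_le_polyFactor (α : Type*) [Fintype α] (n : ℕ) : 1 ≤ polyFactor α n := by
  unfold polyFactor
  refine one_le_pow₀ ?_
  have := Real.add_one_le_exp (1 : ℝ)
  nlinarith [Nat.cast_nonneg (α := ℝ) n]

/-! ### Joint types of triples and the truncated union bound -/

theorem margXX_empirical (x x' : Fin n → X) (y : Fin n → Y) :
    margXX (empirical (fun i => (x i, x' i, y i))) = jointType x x' :=
  push_empirical (fun t : X × X × Y => (t.1, t.2.1)) (fun i => (x i, x' i, y i))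

theorem margXY_empirical (x x' : Fin n → X) (y : Fin n → Y) :
    margXY (empirical (fun i => (x i, x' i, y i))) = jointType x y :=
  push_empirical (fun t : X × X × Y => (t.1, t.2.2)) (fun i => (x i, x' i, y i))

theorem margX'Y_empirical (x x' : Fin n → X) (y : Fin n → Y) :
    margX'Y (empirical (fun i => (x i, x' i, y i))) = jointType x' y :=
  push_empirical (fun t : X × X × Y => (t.2.1, t.2.2)) (fun i => (x i, x' i, y i))

theorem push_rotate_empirical (x x' : Fin n → X) (y : Fin n → Y) :
    push (fun t : X × X × Y => (t.2.1, (t.1, t.2.2))) (empirical (fun i => (x i, x' i, y i)))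
      = jointType x' (fun i => (x i, y i)) :=
  push_empirical (fun t : X × X × Y => (t.2.1, (t.1, t.2.2))) (fun i => (x i, x' i, y i))

open Classical in
/-- The contribution of one joint type `V` to the truncated union bound. -/
theorem sum_channel_mul_min_le (hn : n ≠ 0) {W : X → Y → ℝ} (hW : ∀ x y, 0 ≤ W x y)
    (q : (X × Y → ℝ) → ℝ) (p : X → ℝ) {R Δ ε : ℝ} (hε : 0 ≤ ε)
    (hM : (M : ℝ) ≤ Real.exp (n * (R + ε))) (x : Fin n → X) (V : X × X × Y → ℝ) :
    ∑ y : Fin n → Y, (∏ k, W (x k) (y k)) *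
        min 1 (2 * M * (((confusable p (symmetrize (betaDist R W q)) Δ q x y).filter
          (fun x' => empirical (fun i => (x i, x' i, y i)) = V)).card : ℝ)
            / ((typeClass n p).card : ℝ))
      ≤ 2 * polyFactor X n * Real.exp (n * ε) * Real.exp (-(n * Δ)) := by
  set S : (Fin n → Y) → Finset (Fin n → X) := fun y =>
    (confusable p (symmetrize (betaDist R W q)) Δ q x y).filter
      (fun x' => empirical (fun i => (x i, x' i, y i)) = V) with hS
  have hpoly := polyFactor_pos X n
  by_cases hne : ∀ y, S y = ∅
  · change ∑ y : Fin n → Y, (∏ k, W (x k) (y k)) *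
        min 1 (2 * M * ((S y).card : ℝ) / ((typeClass n p).card : ℝ)) ≤ _
    simp only [hne, Finset.card_empty, Nat.cast_zero, mul_zero, zero_div, min_eq_right zero_le_one,
      Finset.sum_const_zero]
    positivity
  push Not at hne
  obtain ⟨y₀, ⟨x₀, hx₀⟩⟩ := hne
  simp only [hS, Finset.mem_filter, mem_confusable] at hx₀
  obtain ⟨⟨hx₀T, hx₀d, hx₀q⟩, hV⟩ := hx₀
  have hXX : margXX V = jointType x x₀ := by rw [← hV, margXX_empirical]
  have hXY : margXY V = jointType x y₀ := by rw [← hV, margXY_empirical]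
  have hX'Y : margX'Y V = jointType x₀ y₀ := by rw [← hV, margX'Y_empirical]
  -- One realization of `V` by a confusable sequence makes `V` admissible in the minimum defining
  -- `β` at the joint type of `(x, x₀)`, where `β` exceeds `Δ`.
  have hGam : (Δ : EReal) < Gam R W V := by
    refine (lt_of_lt_of_le hx₀d (min_le_left _ _)).trans_le (iInf₂_le V ⟨?_, hXX, ?_⟩)
    · rw [← hV]; exact empirical_mem_stdSimplex hn _
    · rw [hXY, hX'Y]; exact hx₀q
  set I := infoX'_XY V with hI
  set C := univ.filter (fun y : Fin n → Y => jointType x y = jointType x y₀) with hC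
  have hT0 : (0 : ℝ) < (typeClass n p).card := Nat.cast_pos.2 (Finset.card_pos.2 ⟨x₀, hx₀T⟩)
  have hprod0 : ∀ y : Fin n → Y, 0 ≤ ∏ k, W (x k) (y k) := fun y =>
    Finset.prod_nonneg fun k _ => hW _ _
  -- The type `V` fixes the joint type of `x` and `y`, and confines the rivals to a single
  -- conditional type class given the pair `(x, y)`.
  have hSC : ∀ y, (S y).Nonempty → y ∈ C ∧
      ((S y).card : ℝ) ≤ polyFactor X n * (typeClass n p).card * Real.exp (-(n * I)) := by
    rintro y ⟨x₁, hx₁⟩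
    simp only [hS, Finset.mem_filter, mem_confusable, mem_typeClass] at hx₁
    obtain ⟨⟨hx₁T, -, -⟩, hV₁⟩ := hx₁
    constructor
    · simp only [hC, Finset.mem_filter, Finset.mem_univ, true_and]
      rw [← hXY, ← hV₁, margXY_empirical]
    · have h1 := card_condTypeClass_le hn x₁ (fun i => ((x i, y i) : X × Y))
      have hJ : ∀ x' : Fin n → X, empirical (fun i => (x i, x' i, y i)) = V →
          jointType x' (fun i => (x i, y i))
            = push (fun t : X × X × Y => (t.2.1, (t.1, t.2.2))) V := fun x' h => by
        rw [← h, push_rotate_empirical]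
      rw [hJ x₁ hV₁, hx₁T] at h1
      refine le_trans ?_ h1
      refine Nat.cast_le.2 (Finset.card_le_card fun x' hx' => ?_)
      simp only [hS, Finset.mem_filter] at hx'
      simpa using hJ x' hx'.2
  set L := 2 * polyFactor X n * Real.exp (n * ε) * Real.exp (-(n * max (I - R) 0)) with hL
  have hL0 : 0 ≤ L := by positivity
  have hmin : ∀ y, min 1 (2 * M * ((S y).card : ℝ) / ((typeClass n p).card : ℝ))
      ≤ if y ∈ C then L else 0 := by
    intro y
    rcases (S y).eq_empty_or_nonempty with h | h
    · rw [h]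
      simp only [Finset.card_empty, Nat.cast_zero, mul_zero, zero_div]
      refine (min_le_right _ _).trans ?_
      split_ifs
      · exact hL0
      · exact le_rfl
    · obtain ⟨hyC, hcard⟩ := hSC y h
      rw [if_pos hyC]
      -- For `I ≤ R` the truncation at 1 is the useful bound, for `I ≥ R` the count of rivals; `L`
      -- covers both.
      rcases le_total I R with hIR | hIR
      · refine (min_le_left _ _).trans ?_
        rw [hL, max_eq_right (by linarith)]
        have h1 := one_le_polyFactor X n
        have h2 : 1 ≤ Real.exp (n * ε) := Real.one_le_exp (by positivity)
        simp only [mul_zero, neg_zero, Real.exp_zero, mul_one]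
        nlinarith
      · refine (min_le_right _ _).trans ?_
        rw [div_le_iff₀ hT0]
        calc 2 * M * ((S y).card : ℝ)
            ≤ 2 * Real.exp (n * (R + ε)) *
              (polyFactor X n * (typeClass n p).card * Real.exp (-(n * I))) := by gcongr
          _ = 2 * polyFactor X n * (Real.exp (n * (R + ε)) * Real.exp (-(n * I)))
              * (typeClass n p).card := by ring
          _ = L * (typeClass n p).card := by
              have hexp : Real.exp (n * (R + ε)) * Real.exp (-(n * I))
                  = Real.exp (n * ε) * Real.exp (-(n * (I - R))) := by
                rw [← Real.exp_add, ← Real.exp_add]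
                congr 1
                ring
              rw [hL, max_eq_left (by linarith), hexp]
              ring
  have hsum : ∑ y : Fin n → Y, (∏ k, W (x k) (y k)) *
        min 1 (2 * M * ((S y).card : ℝ) / ((typeClass n p).card : ℝ))
      ≤ (∑ y ∈ C, ∏ k, W (x k) (y k)) * L := by
    calc _ ≤ ∑ y : Fin n → Y, (∏ k, W (x k) (y k)) * (if y ∈ C then L else 0) :=
          Finset.sum_le_sum fun y _ => mul_le_mul_of_nonneg_left (hmin y) (hprod0 y)
      _ = _ := by
          simp only [mul_ite, mul_zero]
          rw [Finset.sum_ite_mem, Finset.univ_inter, Finset.sum_mul]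
  refine hsum.trans ?_
  by_cases hs : ∀ a b, W a b = 0 → margXY V (a, b) = 0
  · rw [Gam_eq_gamReal hs, EReal.coe_lt_coe_iff, gamReal, hXY] at hGam
    rw [hXY] at hs
    have h1 := sum_channel_condTypeClass_le hn W hW x y₀ hs
    set D := ∑ a, ∑ b, jointType x y₀ (a, b) * Real.log (jointType x y₀ (a, b) /
          (push Prod.fst (jointType x y₀) a * W a b)) with hD
    calc (∑ y ∈ C, ∏ k, W (x k) (y k)) * L ≤ Real.exp (-(n * D)) * L := by gcongr
      _ = 2 * polyFactor X n * Real.exp (n * ε) * Real.exp (-(n * (D + max (I - R) 0))) := by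
          rw [hL, mul_add, neg_add, Real.exp_add]; ring
      _ ≤ _ := by gcongr
  -- Infinite divergence: `V` charges a forbidden transition, so every compatible output has channel
  -- probability 0.
  · push Not at hs
    obtain ⟨a, b, hab, hVab⟩ := hs
    rw [hXY] at hVab
    rw [Finset.sum_eq_zero, zero_mul]
    · positivity
    · intro y hy
      have hy' : jointType x y = jointType x y₀ := by simpa [hC] using hy
      exact prod_eq_zero_of_jointType hab (by rw [hy']; exact hVab)

open Classical in
theorem sum_channel_mul_min_confusable_le (hn : n ≠ 0) {W : X → Y → ℝ} (hW : ∀ x y, 0 ≤ W x y)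
    (q : (X × Y → ℝ) → ℝ) (p : X → ℝ) {R Δ ε : ℝ} (hε : 0 ≤ ε)
    (hM : (M : ℝ) ≤ Real.exp (n * (R + ε))) (x : Fin n → X) :
    ∑ y : Fin n → Y, (∏ k, W (x k) (y k)) *
        min 1 (2 * M * ((confusable p (symmetrize (betaDist R W q)) Δ q x y).card : ℝ)
            / ((typeClass n p).card : ℝ))
      ≤ polyFactor (X × X × Y) n *
        (2 * polyFactor X n * Real.exp (n * ε) * Real.exp (-(n * Δ))) := by
  have hpoly := polyFactor_pos X n
  have hsplit : ∀ y : Fin n → Y,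
      2 * M * ((confusable p (symmetrize (betaDist R W q)) Δ q x y).card : ℝ)
        / ((typeClass n p).card : ℝ)
      = ∑ V ∈ types (X × X × Y) n,
        2 * M * (((confusable p (symmetrize (betaDist R W q)) Δ q x y).filter
          (fun x' => empirical (fun i => (x i, x' i, y i)) = V)).card : ℝ)
            / ((typeClass n p).card : ℝ) := by
    intro y
    rw [← Finset.sum_div, ← Finset.mul_sum, ← Nat.cast_sum]
    congr 3
    exact Finset.card_eq_sum_card_fiberwise fun x' _ =>
      Finset.mem_coe.2 (Finset.mem_image_of_mem _ (Finset.mem_univ _))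
  calc _ ≤ ∑ y : Fin n → Y, (∏ k, W (x k) (y k)) * ∑ V ∈ types (X × X × Y) n,
        min 1 (2 * M * (((confusable p (symmetrize (betaDist R W q)) Δ q x y).filter
          (fun x' => empirical (fun i => (x i, x' i, y i)) = V)).card : ℝ)
            / ((typeClass n p).card : ℝ)) := by
        refine Finset.sum_le_sum fun y _ => mul_le_mul_of_nonneg_left ?_
          (Finset.prod_nonneg fun k _ => hW _ _)
        rw [hsplit]
        exact min_one_sum_le _ _ fun V => by positivity
    _ = ∑ V ∈ types (X × X × Y) n, ∑ y : Fin n → Y, (∏ k, W (x k) (y k)) *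
        min 1 (2 * M * (((confusable p (symmetrize (betaDist R W q)) Δ q x y).filter
          (fun x' => empirical (fun i => (x i, x' i, y i)) = V)).card : ℝ)
            / ((typeClass n p).card : ℝ)) := by
        simp only [Finset.mul_sum]
        rw [Finset.sum_comm]
    _ ≤ ∑ V ∈ types (X × X × Y) n,
        2 * polyFactor X n * Real.exp (n * ε) * Real.exp (-(n * Δ)) :=
        Finset.sum_le_sum fun V _ => sum_channel_mul_min_le hn hW q p hε hM x V
    _ ≤ _ := by
        rw [Finset.sum_const, nsmul_eq_mul]
        exact mul_le_mul_of_nonneg_right (card_types_le n) (by positivity)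

-- Codebooks are grouped by the value `x` of the sent codeword, because the channel probability
-- depends on the codebook only through it.
open Classical in
theorem ensembleErrorProb_eq (p : X → ℝ) (d : (X × X → ℝ) → EReal) (Δ : ℝ)
    (W : X → Y → ℝ) (q : (X × Y → ℝ) → ℝ) :
    ensembleErrorProb n M p d Δ W q = (1 / (M : ℝ)) * ∑ m : Fin M, ∑ x : Fin n → X,
      ∑ y : Fin n → Y, (∏ k, W (x k) (y k)) *
        ∑ c ∈ univ.filter (fun c : Fin M → Fin n → X => c m = x),
          (if ∃ i, i ≠ m ∧ q (jointType (c m) y) ≤ q (jointType (c i) y) then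
            codebookProb p d Δ c else 0) := by
  have h : ∀ m : Fin M, ∑ x : Fin n → X, ∑ y : Fin n → Y, (∏ k, W (x k) (y k)) *
        ∑ c ∈ univ.filter (fun c : Fin M → Fin n → X => c m = x),
          (if ∃ i, i ≠ m ∧ q (jointType (c m) y) ≤ q (jointType (c i) y) then
            codebookProb p d Δ c else 0)
      = ∑ c : Fin M → Fin n → X, codebookProb p d Δ c * ∑ y : Fin n → Y,
        (if ∃ i, i ≠ m ∧ q (jointType (c m) y) ≤ q (jointType (c i) y) then
          ∏ k, W (c m k) (y k) else 0) := by
    intro m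
    rw [← Finset.sum_fiberwise univ (fun c : Fin M → Fin n → X => c m)]
    refine Finset.sum_congr rfl fun x _ => ?_
    simp only [Finset.mul_sum]
    rw [Finset.sum_comm]
    refine Finset.sum_congr rfl fun c hc => Finset.sum_congr rfl fun y _ => ?_
    rw [(Finset.mem_filter.1 hc).2]
    split_ifs
    · rw [mul_comm]
    · simp
  simp only [h]
  rw [ensembleErrorProb, Finset.sum_comm, Finset.mul_sum]
  refine Finset.sum_congr rfl fun c _ => ?_
  rw [errorProb, ← Finset.mul_sum]
  ring

/-- The bound on the channel sum is uniform in the sent sequence, and the weights `2/T` over the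
type class add up to 2. -/
theorem ensembleErrorProb_le (hn : n ≠ 0) {W : X → Y → ℝ} (hW : ∀ x y, 0 ≤ W x y)
    (q : (X × Y → ℝ) → ℝ) {p : X → ℝ} {R Δ ε : ℝ} (hε : 0 ≤ ε)
    (hM : (M : ℝ) ≤ Real.exp (n * (R + ε))) (hT : (typeClass n p).Nonempty)
    (hcard : ∀ (c : Fin M → Fin n → X) (i : Fin M), (∀ j < i, c j ∈ typeClass n p) →
      ((typeClass n p).card : ℝ)
        ≤ 2 * (available p (symmetrize (betaDist R W q)) Δ c i).card) :
    ensembleErrorProb n M p (symmetrize (betaDist R W q)) Δ W q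
      ≤ 2 * (polyFactor (X × X × Y) n *
        (2 * polyFactor X n * Real.exp (n * ε) * Real.exp (-(n * Δ)))) := by
  classical
  set K := polyFactor (X × X × Y) n *
        (2 * polyFactor X n * Real.exp (n * ε) * Real.exp (-(n * Δ))) with hK
  have hK0 : 0 ≤ K := by
    have h1 := polyFactor_pos X n
    have h2 := polyFactor_pos (X × X × Y) n
    positivity
  have hT0 : (0 : ℝ) < (typeClass n p).card := Nat.cast_pos.2 (Finset.card_pos.2 hT)
  set d := symmetrize (betaDist R W q) with hd
  set T : ℝ := ((typeClass n p).card : ℝ) with hTdef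
  have hx : ∀ (m : Fin M) (x : Fin n → X), ∑ y : Fin n → Y, (∏ k, W (x k) (y k)) *
        ∑ c ∈ univ.filter (fun c : Fin M → Fin n → X => c m = x),
          (if ∃ i, i ≠ m ∧ q (jointType (c m) y) ≤ q (jointType (c i) y) then
            codebookProb p d Δ c else 0)
      ≤ if x ∈ typeClass n p then 2 / T * K else 0 := by
    intro m x
    split_ifs with hxT
    · calc _ ≤ ∑ y : Fin n → Y, (∏ k, W (x k) (y k)) *
            (2 / T * min 1 (2 * M * (confusable p d Δ q x y).card / T)) :=
            Finset.sum_le_sum fun y _ => mul_le_mul_of_nonneg_left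
              (sum_codebookProb_confused_le q hT (fun _ _ => symmetrize_jointType_comm _ _ _)
                hcard m x y)
              (Finset.prod_nonneg fun k _ => hW _ _)
        _ = 2 / T * ∑ y : Fin n → Y, (∏ k, W (x k) (y k)) *
            min 1 (2 * M * (confusable p d Δ q x y).card / T) := by
            rw [Finset.mul_sum]
            exact Finset.sum_congr rfl fun y _ => by ring
        _ ≤ 2 / T * K := mul_le_mul_of_nonneg_left
            (sum_channel_mul_min_confusable_le hn hW q p hε hM x) (by positivity)
    · refine le_of_eq (Finset.sum_eq_zero fun y _ => ?_)
      rw [Finset.sum_eq_zero, mul_zero]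
      intro c hc
      have hcm : c m = x := (Finset.mem_filter.1 hc).2
      have : codebookProb p d Δ c = 0 := by
        by_contra h0
        exact hxT (hcm ▸ (mem_available.1 (mem_available_of_codebookProb_ne_zero h0 m)).1)
      rw [this, ite_self]
  rw [ensembleErrorProb_eq]
  calc _ ≤ (1 / (M : ℝ)) * ∑ _m : Fin M, ∑ x : Fin n → X,
        (if x ∈ typeClass n p then 2 / T * K else 0) := by
        refine mul_le_mul_of_nonneg_left (Finset.sum_le_sum fun m _ =>
          Finset.sum_le_sum fun x _ => hx m x) (by positivity)
    _ = (1 / (M : ℝ)) * (M * (2 * K)) := by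
        congr 1
        rw [Finset.sum_ite_mem, Finset.univ_inter]
        simp only [Finset.sum_const, Finset.card_univ, Fintype.card_fin, nsmul_eq_mul]
        rw [← hTdef]
        field_simp
    -- Only an inequality, because `M = 0` makes `1 / M * M` equal to 0.
    _ ≤ 2 * K := by
        rw [← mul_assoc]
        have : 1 / (M : ℝ) * M ≤ 1 := by
          rw [one_div]; exact inv_mul_le_one
        nlinarith

end ErrorProbability

/-- The exponents balance exactly: the polynomial factors and the excess of `M` over `exp(nR)` cost
`δ/4` each, the passage from `P` to `P_n` costs `δ/2`, and `exp(nδ)` costs `δ`, which exhausts `2δ`.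
-/
theorem eventually_volumeCondition {X Y : Type*} [Fintype X] [Fintype Y] [DecidableEq X]
    [DecidableEq Y] (W : X → Y → ℝ) {q : (X × Y → ℝ) → ℝ}
    (hq : ContinuousOn q (stdSimplex ℝ (X × Y))) (P : X → ℝ) {R δ Δ : ℝ} (hδ : 0 < δ)
    (hrate : (R : EReal) ≤ minInfo P (betaDist R W q) Δ - ((2 * δ : ℝ) : EReal))
    {Pn : ℕ → X → ℝ} (hPn : ∀ᶠ n : ℕ in atTop, IsTypeApprox P n (Pn n)) {M : ℕ → ℕ}
    (hM : ∀ ε > 0, ∀ᶠ n : ℕ in atTop, (M n : ℝ) ≤ Real.exp (n * (R + ε))) :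
    ∀ᶠ n : ℕ in atTop,
      VolumeCondition n (M n) (Pn n) (symmetrize (betaDist R W q)) Δ δ := by
  have hr : ∀ Q ∈ stdSimplex ℝ (X × X), push Prod.fst Q = P → push Prod.snd Q = P →
      betaDist R W q Q ≤ (Δ : EReal) → R + 2 * δ ≤ mutualInfo Q := by
    intro Q hQ h1 h2 hβ
    have h : minInfo P (betaDist R W q) Δ ≤ (mutualInfo Q : EReal) :=
      iInf₂_le Q ⟨hQ, h1, h2, hβ⟩
    have h' := hrate.trans (EReal.sub_le_sub h le_rfl)
    rw [← EReal.coe_sub, EReal.coe_le_coe_iff] at h'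
    linarith
  obtain ⟨k, hk⟩ := exists_forall_le_mutualInfo R W hq P Δ (R + 2 * δ) hr (half_pos hδ)
  have hδ4 : 0 < δ / 4 := by positivity
  filter_upwards [hPn, hM (δ / 4) hδ4, eventually_ge_atTop (k + 1),
    eventually_mul_pow_le_exp 1 (Fintype.card (X × X) + Fintype.card X) hδ4] with n hn hMn hnk hpoly
  have hn0 : n ≠ 0 := by omega
  have hclose : ∀ a, |Pn n a - P a| ≤ 1 / ((k : ℝ) + 1) := fun a => by
    refine (hn.2.2 a).trans (one_div_le_one_div_of_le (by positivity) ?_)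
    exact_mod_cast hnk
  intro x hx
  have hball := card_ball_le hn0 (p := Pn n) (d := betaDist R W q) (Δ := Δ)
    (r := R + 2 * δ - δ / 2) (fun Q hQ h1 h2 hβ =>
      hk Q hQ (by rw [h1]; exact hclose) (by rw [h2]; exact hclose) hβ) x hx
  have hpoly' : polyFactor (X × X) n * polyFactor X n ≤ Real.exp (n * (δ / 4)) := by
    rw [polyFactor, polyFactor, ← pow_add, ← one_mul ((_ : ℝ) ^ _)]
    exact hpoly
  set T : ℝ := ((typeClass n (Pn n)).card : ℝ) with hT
  calc _ ≤ Real.exp (n * (R + δ / 4)) * Real.exp (n * δ) * (polyFactor (X × X) n *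
        (polyFactor X n * T * Real.exp (-(n * (R + 2 * δ - δ / 2))))) := by gcongr
    _ = (polyFactor (X × X) n * polyFactor X n) * (Real.exp (n * (R + δ / 4)) * Real.exp (n * δ) *
        Real.exp (-(n * (R + 2 * δ - δ / 2)))) * T := by ring
    _ ≤ Real.exp (n * (δ / 4)) * (Real.exp (n * (R + δ / 4)) * Real.exp (n * δ) *
        Real.exp (-(n * (R + 2 * δ - δ / 2)))) * T := by gcongr
    _ = T := by
        rw [← Real.exp_add, ← Real.exp_add, ← Real.exp_add]
        have : (n : ℝ) * (δ / 4) + (n * (R + δ / 4) + n * δ + -(n * (R + 2 * δ - δ / 2))) = 0 := by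
          ring
        rw [this, Real.exp_zero, one_mul]

end

end RGV

/-! ### The main theorem -/

theorem mainTheorem5 {X Y : Type*} [Fintype X] [Fintype Y] [DecidableEq X] [DecidableEq Y]
    (W : X → Y → ℝ) (hW : ∀ x, W x ∈ stdSimplex ℝ Y)
    (q : (X × Y → ℝ) → ℝ) (hq : ContinuousOn q (stdSimplex ℝ (X × Y)))
    (P : X → ℝ) (hP : P ∈ stdSimplex ℝ X)
    (R δ Δ : ℝ) (hR : 0 < R) (hδ : 0 < δ)
    (hrate : (R : EReal) ≤ RGV.minInfo P (RGV.betaDist R W q) Δ - ((2 * δ : ℝ) : EReal))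
    (Pn : ℕ → X → ℝ) (hPn : ∀ᶠ n : ℕ in Filter.atTop, RGV.IsTypeApprox P n (Pn n))
    (M : ℕ → ℕ)
    (hM : ∀ ε > 0, ∀ᶠ n : ℕ in Filter.atTop, (M n : ℝ) ≤ Real.exp (n * (R + ε))) :
    (∀ᶠ n : ℕ in Filter.atTop,
      RGV.VolumeCondition n (M n) (Pn n) (RGV.symmetrize (RGV.betaDist R W q)) Δ δ ∧
      RGV.NeverStuck n (M n) (Pn n) (RGV.symmetrize (RGV.betaDist R W q)) Δ) ∧
    RGV.DotLE
      (fun n => RGV.ensembleErrorProb n (M n) (Pn n)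
        (RGV.symmetrize (RGV.betaDist R W q)) Δ W q)
      (fun n => Real.exp (-(n * Δ))) := by
  have hvol := RGV.eventually_volumeCondition W hq P hδ hrate hPn hM
  have hexp : ∀ᶠ n : ℕ in Filter.atTop, 2 ≤ Real.exp (n * δ) := by
    simpa using RGV.eventually_mul_pow_le_exp 2 0 hδ
  refine ⟨?_, ?_⟩
  · filter_upwards [hvol, hexp, hPn] with n h1 h2 h3
    exact ⟨h1, h1.neverStuck h2 h3.1⟩
  · intro ε hε
    -- Half of `ε` absorbs the excess of the number of codewords over `exp(nR)`, the other half the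
    -- polynomial factors together with the constant `4 = 2 * 2`.
    filter_upwards [hvol, hexp, hPn, hM (ε / 2) (half_pos hε), Filter.eventually_ne_atTop 0,
      RGV.eventually_mul_pow_le_exp 4 (Fintype.card (X × X × Y) + Fintype.card X)
        (half_pos hε)] with n h1 h2 h3 h4 h5 h6
    refine (RGV.ensembleErrorProb_le h5 (fun x y => (hW x).1 y) q (half_pos hε).le h4 h3.1
      (h1.card_le_two_mul_card_available h2)).trans ?_
    have h7 : 4 * (RGV.polyFactor (X × X × Y) n * RGV.polyFactor X n) ≤ Real.exp (n * (ε / 2)) := by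
      rw [RGV.polyFactor, RGV.polyFactor, ← pow_add]
      exact h6
    calc _ = 4 * (RGV.polyFactor (X × X × Y) n * RGV.polyFactor X n) * Real.exp (n * (ε / 2))
          * Real.exp (-(n * Δ)) := by ring
      _ ≤ Real.exp (n * (ε / 2)) * Real.exp (n * (ε / 2)) * Real.exp (-(n * Δ)) := by gcongr
      _ = Real.exp (n * ε) * Real.exp (-(n * Δ)) := by
          rw [← Real.exp_add (n * (ε / 2))]
          congr 2
          ring
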